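/- Consider the two families of quadratic vector fields $$\text{(G)}\quad \dot x=-y+Bx^2+\mu_2y^2+(\mu_4+B\mu_5)x,\qquad \dot y=x+xy+\mu_3y^2+(1-2B)\mu_5y,$$ $$\text{(S)}\quad \dot x=-y+Bx^2+\mu_2y^2+\mu_5x,\qquad \dot y=x+(\mu_4+\mu_5)x^2+xy+\mu_3y^2,$$ (which unfold $\dot x=-y+B_0x^2$, $\dot y=x+xy$ for $B_0\ne1$ and $B_0=1$ respectively), with $B$ near $B_0>\frac12$ and $(\mu_2,\mu_3)=(\nu^2\overline\mu_2,\nu\overline\mu_3)$. Near the nilpotent point at infinity put $(v,w)=(-x/y,1/y)$ and blow up by $(v,w,\nu)=(r\overline x,r^2,r\rho)$. After multiplication by the positive factor $2w/r$ (i.e. $2r$) the system extends to a polynomial vector field in $(r,\rho,\overline x)$ of the form $$\dot r=r\,g,\qquad \dot\rho=-\rho\, g,\qquad \dot{\overline x}=Q(r,\rho,\overline x),$$ whose restriction to the invariant plane $r=0$ is, for both families, $$\dot\rho=-\rho(\overline x-\overline\mu_3\rho),\qquad \dot{\overline x}=2+(1-2B)\overline x^2-2\overline\mu_2\rho^2-\overline\mu_3\overline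 x\rho .$$ Let $P_3=(0,0,\beta)$, $P_4=(0,0,-\beta)$, $\beta=\sqrt{2/(2B-1)}$, be its singular points on $r=\rho=0$, and let $\sigma=2(2B-1)$, $\sigma_0=2(2B_0-1)$. For $i=3,4$ let $(r,\rho,\overline x_i)$ be normalizing coordinates of class $C^k$, $k\ge2$, on a cube centred at $P_i$: $\overline x_i$ vanishes at $P_i$, the map $(r,\rho,\overline x)\mapsto(r,\rho,\overline x_i)$ is injective, $g$ does not vanish, and the vector field divided by $g$ becomes $$\dot r=r,\quad \dot\rho=-\rho,\quad \dot{\overline x}_i=-(\sigma+\varphi_i(\nu))\overline x_i+\Phi_i(\nu,r^p\overline x_i^q)\overline x_i+\rho^p\eta_i(\nu),\qquad \nu=r\rho,$$ with polynomials $\varphi_i,\Phi_i,\eta_i$, where $\Phi_i=0$, $\eta_i=0$ if $\sigma_0\notin\mathbb Q$, while $\Phi_i(\nu,0)\equiv0$ if $\sigma_0=p/q$ in lowest terms, and $\eta_i=0$ if moreover $q\neq1$. They are normalized by $\partial\overline x_3/\partial\overline x=-1$ at $P_3$ and $\partial\overline x_4/\partial\overline x=1$ at $P_4$ and, if $\sigma_0=1$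 (that is, $B_0=\frac34$), also by $\partial\overline x_i/\partial\rho=0$ at $P_i$. Let $X_0>0$ be such that the sections $\Sigma_i=\{\overline x_i=X_0\}$ meet the axis $r=\rho=0$ inside the charts; near the axis they are parameterized by $(r,\rho)$. The transition map from $\Sigma_3$ to $\Sigma_4$ along the trajectories in backward time has, near $(0,0)$, the form $$(r,\rho)\mapsto\bigl(rF(r,\rho),\ \rho F(r,\rho)^{-1}\bigr)$$ with $F$ continuous and nonzero at $(0,0)$. **Lemma.** Let $B_0>\frac12$. There is $X^*>0$ such that for every $X_0\in(0,X^*)$ there are $\delta>0$ and a continuous, nowhere vanishing function $c$ on $(B_0-\delta,B_0+\delta)$ with the following property. For each of the two families, all $B\in(B_0-\delta,B_0+\delta)$, all $\overline\mu_2,\overline\mu_3,\mu_4,\mu_5\in\mathbb R$ (in particular for $(\overline\mu_2,\overline\mu_3)\in\mathbb S^1$), and all normalizing coordinates as above for which $\Sigma_3$ and $\Sigma_4$ meet the axis inside the charts, such an $F$ exists, and every such $F$ satisfies $F(0,0)=1$; moreover $S(\rho)=\rho F(0,\rho)$ is differentiable near $0$ and twice differentiable at $0$ with $$S''(0)=c(B)\,\overline\mu_3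 ,$$ and the $\rho$-component $\rho F(0,\rho)^{-1}$ of the transition on $r=0$ is likewise differentiable near $0$ and twice differentiable at $0$, with second derivative $-c(B)\,\overline\mu_3$ at $0$. -/

import Mathlib

open Set Filter Topology

noncomputable section

namespace NilpotentBlowUp

/-- The two five-parameter unfoldings, inside quadratic systems, of
`x' = -y + B₀ x², y' = x + x y`: `generic` is used for `B₀ ≠ 1` and `special` for `B₀ = 1`. -/
inductive Unfolding
  | generic
  | special

/-- The parameters `(B, μ̄₂, μ̄₃, μ₄, μ₅)`, where `μ₂ = ν² μ̄₂` and `μ₃ = ν μ̄₃`. -/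
structure Params where
  B : ℝ
  mu2 : ℝ
  mu3 : ℝ
  mu4 : ℝ
  mu5 : ℝ

/-- The quadratic vector field with parameters `(B, m₂, m₃, μ₄, μ₅)` (not rescaled):
generic: `x' = -y + B x² + m₂ y² + (μ₄ + B μ₅) x`, `y' = x + x y + m₃ y² + (1 - 2B) μ₅ y`;
special: `x' = -y + B x² + m₂ y² + μ₅ x`, `y' = x + (μ₄ + μ₅) x² + x y + m₃ y²`. -/
def quadraticField (u : Unfolding) (B m2 m3 mu4 mu5 : ℝ) (z : ℝ × ℝ) : ℝ × ℝ :=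
  match u with
  | .generic =>
      (-z.2 + B * z.1 ^ 2 + m2 * z.2 ^ 2 + (mu4 + B * mu5) * z.1,
       z.1 + z.1 * z.2 + m3 * z.2 ^ 2 + (1 - 2 * B) * mu5 * z.2)
  | .special =>
      (-z.2 + B * z.1 ^ 2 + m2 * z.2 ^ 2 + mu5 * z.1,
       z.1 + (mu4 + mu5) * z.1 ^ 2 + z.1 * z.2 + m3 * z.2 ^ 2)

/-- The chart `ȳ = 1` of the blow-up of the nilpotent point at infinity: with
`(v, w) = (-x / y, 1 / y)` and `(v, w, ν) = (r x̄, r², r ρ)`, the point `(r, ρ, x̄)`, `r ≠ 0`,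
represents the point `(x, y) = (-v / w, 1 / w)` of the plane, for the parameter `ν = r ρ`. -/
def toPlane (p : ℝ × ℝ × ℝ) : ℝ × ℝ :=
  (-p.2.2 / p.1, 1 / p.1 ^ 2)

/-- The function `g` such that the blown-up system satisfies `r' = r g`, `ρ' = -ρ g`. -/
def rate (u : Unfolding) (A : Params) (p : ℝ × ℝ × ℝ) : ℝ :=
  let r := p.1
  let ρ := p.2.1
  let x := p.2.2
  match u with
  | .generic => x - A.mu3 * ρ - (1 - 2 * A.B) * A.mu5 * r + r ^ 2 * x
  | .special => x - A.mu3 * ρ + r ^ 2 * x - (A.mu4 + A.mu5) * r * x ^ 2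

/-- The blown-up vector field in the coordinates `(r, ρ, x̄)`. It extends polynomially to the
critical locus `r ρ = 0`; see `toPlane_blowUpField` for its relation to the quadratic system. -/
def blowUpField (u : Unfolding) (A : Params) (p : ℝ × ℝ × ℝ) : ℝ × ℝ × ℝ :=
  let r := p.1
  let ρ := p.2.1
  let x := p.2.2
  (r * rate u A p, -ρ * rate u A p,
    (match u with
      | .generic =>
          2 * (1 + (1 - A.B) * x ^ 2 - A.mu2 * ρ ^ 2 - A.mu3 * ρ * x
            + ((3 * A.B - 1) * A.mu5 + A.mu4) * r * x + r ^ 2 * x ^ 2)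
      | .special =>
          2 * (1 + (1 - A.B) * x ^ 2 - A.mu2 * ρ ^ 2 - A.mu3 * ρ * x
            + A.mu5 * r * x + r ^ 2 * x ^ 2 - (A.mu4 + A.mu5) * r * x ^ 3))
      - x * rate u A p)

/-- For `r ≠ 0`, `blowUpField` is mapped by `toPlane` to `2 r` times the quadratic vector field with
parameters `μ₂ = ν² μ̄₂` and `μ₃ = ν μ̄₃`, `ν = r ρ`. -/
theorem toPlane_blowUpField (u : Unfolding) (A : Params) (p : ℝ × ℝ × ℝ) (hr : p.1 ≠ 0) :
    fderiv ℝ toPlane p (blowUpField u A p) =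
      (2 * p.1) • quadraticField u A.B ((p.1 * p.2.1) ^ 2 * A.mu2) (p.1 * p.2.1 * A.mu3)
        A.mu4 A.mu5 (toPlane p) := by
  have h1 : HasFDerivAt (fun p : ℝ × ℝ × ℝ => p.1) (ContinuousLinearMap.fst ℝ ℝ (ℝ × ℝ)) p :=
    hasFDerivAt_fst
  have h3 : HasFDerivAt (fun p : ℝ × ℝ × ℝ => p.2.2)
      ((ContinuousLinearMap.snd ℝ ℝ ℝ).comp (ContinuousLinearMap.snd ℝ ℝ (ℝ × ℝ))) p :=
    hasFDerivAt_snd.comp p hasFDerivAt_snd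
  have hi : HasFDerivAt (fun p : ℝ × ℝ × ℝ => (p.1)⁻¹)
      ((-(p.1 ^ 2)⁻¹) • ContinuousLinearMap.fst ℝ ℝ (ℝ × ℝ)) p :=
    (hasDerivAt_inv hr).comp_hasFDerivAt p h1
  have h := (h3.fun_neg.fun_mul hi).prodMk (hi.fun_mul hi)
  have he : toPlane = fun p : ℝ × ℝ × ℝ =>
      (-p.2.2 * (p.1)⁻¹, (p.1)⁻¹ * (p.1)⁻¹) := by
    funext p
    simp only [toPlane, div_eq_mul_inv, one_mul, pow_two, mul_inv]
  rw [he, h.fderiv]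
  obtain ⟨r, ρ, x⟩ := p
  simp only at hr
  cases u
  all_goals
    ext
    all_goals
      simp [blowUpField, rate, quadraticField]
      field_simp
      ring

/-- The right-hand side `Y' = -(σ + φ(ν)) Y + Φ(ν, r^p Y^q) Y + ρ^p η(ν)`, `ν = r ρ`, of the normal
form, whose other two equations are `r' = r` and `ρ' = -ρ`. -/
def normalFormRHS (σ : ℝ) (p q : ℕ) (φ η : Polynomial ℝ) (Φ : MvPolynomial (Fin 2) ℝ)
    (r ρ Y : ℝ) : ℝ :=
  -(σ + φ.eval (r * ρ)) * Y + MvPolynomial.eval ![r * ρ, r ^ p * Y ^ q] Φ * Y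
    + ρ ^ p * η.eval (r * ρ)

/-- Which terms are allowed in the normal form near the value `σ₀` of the eigenvalue ratio: none but
`φ` if `σ₀` is irrational; if `σ₀ = p / q` in lowest terms, also `Φ` with `Φ(ν, 0) = 0`, and `η` if
`σ₀` is an integer. -/
def NormalFormTerms (σ₀ : ℝ) (p q : ℕ) (η : Polynomial ℝ) (Φ : MvPolynomial (Fin 2) ℝ) : Prop :=
  (Irrational σ₀ ∧ Φ = 0 ∧ η = 0) ∨
  (0 < p ∧ 0 < q ∧ Nat.Coprime p q ∧ σ₀ = (p : ℝ) / q ∧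
    (∀ ν : ℝ, MvPolynomial.eval ![ν, 0] Φ = 0) ∧ (q ≠ 1 → η = 0))

/-- The eigenvalue ratio `σ = 2 (2B - 1)` at the points `P₃` and `P₄`. -/
def ratio (B : ℝ) : ℝ := 2 * (2 * B - 1)

/-- The singular points `P₃ = (0, 0, β)` (for `s = 1`) and `P₄ = (0, 0, -β)` (for `s = -1`), where
`β = √(2 / (2B - 1))`. -/
def singularPt (B s : ℝ) : ℝ × ℝ × ℝ := (0, 0, s * √(2 / (2 * B - 1)))

/-- `G` is the third coordinate of a normalizing chart `(r, ρ, x̄) ↦ (r, ρ, G)` of class `C^k` at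
`P₃` (`s = 1`) or `P₄` (`s = -1`), defined on the cube (ball for the sup norm) of radius `e`, for
parameters `A` close to parameters for which `B = B₀`.
The blown-up field becomes, up to the nonvanishing factor `rate`, the normal form of eigenvalue
ratio `σ` near `σ₀`. The new coordinate has the normalization `G = β - s x̄ + ⋯`; in the resonant
case `σ₀ = 1` it is tangent to `β - s x̄` also in the direction of `ρ`. -/
structure IsNormalizingChart (u : Unfolding) (B₀ : ℝ) (A : Params) (s : ℝ) (k : ℕ) (e : ℝ)
    (G : ℝ × ℝ × ℝ → ℝ) : Prop where
  pos : 0 < e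
  contDiffOn : ContDiffOn ℝ k G (Metric.ball (singularPt A.B s) e)
  injOn : InjOn (fun z : ℝ × ℝ × ℝ => (z.1, z.2.1, G z)) (Metric.ball (singularPt A.B s) e)
  map_center : G (singularPt A.B s) = 0
  deriv_x : fderiv ℝ G (singularPt A.B s) (0, 0, 1) = -s
  deriv_rho : ratio B₀ = 1 → fderiv ℝ G (singularPt A.B s) (0, 1, 0) = 0
  rate_ne_zero : ∀ z ∈ Metric.ball (singularPt A.B s) e, rate u A z ≠ 0
  normalForm : ∃ (p q : ℕ) (φ η : Polynomial ℝ) (Φ : MvPolynomial (Fin 2) ℝ),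
    NormalFormTerms (ratio B₀) p q η Φ ∧
    ∀ z ∈ Metric.ball (singularPt A.B s) e,
      fderiv ℝ G z (blowUpField u A z) =
        rate u A z * normalFormRHS (ratio A.B) p q φ η Φ z.1 z.2.1 (G z)

/-- The section `{G = X₀}` in a chart at `P₃` (`s = 1`) or `P₄` (`s = -1`) of radius `e`. -/
def chartSection (B s e : ℝ) (G : ℝ × ℝ × ℝ → ℝ) (X₀ : ℝ) : Set (ℝ × ℝ × ℝ) :=
  {z | z ∈ Metric.ball (singularPt B s) e ∧ G z = X₀}

/-- Some trajectory of the vector field `X` goes from `a` to `b` in forward time. -/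
def FlowsTo (X : ℝ × ℝ × ℝ → ℝ × ℝ × ℝ) (a b : ℝ × ℝ × ℝ) : Prop :=
  ∃ (T : ℝ) (γ : ℝ → ℝ × ℝ × ℝ), 0 ≤ T ∧ γ 0 = a ∧ γ T = b ∧
    IsIntegralCurveOn γ (fun _ => X) (Icc 0 T)

/-- The transition map from `Sec₃` to `Sec₄` along the trajectories of `X` in backward time, both
sections being parameterized by `(r, ρ)`, has near `(0, 0)` the form
`(r, ρ) ↦ (r F(r, ρ), ρ F(r, ρ)⁻¹)`, with `F` continuous and nonzero at `(0, 0)`. -/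
def IsTransitionFactor (X : ℝ × ℝ × ℝ → ℝ × ℝ × ℝ) (Sec₃ Sec₄ : Set (ℝ × ℝ × ℝ))
    (F : ℝ × ℝ → ℝ) : Prop :=
  ContinuousAt F (0, 0) ∧ F (0, 0) ≠ 0 ∧
  ∀ᶠ z in 𝓝 ((0, 0) : ℝ × ℝ), ∃ x₃ x₄ : ℝ,
    (z.1, z.2, x₃) ∈ Sec₃ ∧ (z.1 * F z, z.2 * (F z)⁻¹, x₄) ∈ Sec₄ ∧
      FlowsTo X (z.1 * F z, z.2 * (F z)⁻¹, x₄) (z.1, z.2, x₃)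

/-- `S` is differentiable near `a`, and its second derivative at `a` exists and equals `l`. -/
def HasSecondDerivAt (S : ℝ → ℝ) (l a : ℝ) : Prop :=
  (∀ᶠ x in 𝓝 a, DifferentiableAt ℝ S x) ∧ HasDerivAt (deriv S) l a

end NilpotentBlowUp

end

/-!
The field satisfies `r' = r g`, `ρ' = -ρ g`, so along a trajectory that ends at a point of `Σ₃`
over `z = (r, ρ)` one has `r(t) = r exp (h(t))`, `ρ(t) = ρ exp (-h(t))`, where `h' = g`, and
`h = 0` on `Σ₃`. The transition factor is therefore `F(z) = exp (h)`, evaluated where the trajectory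
leaves `Σ₄`. Near the axis `r = ρ = 0` between the two sections `x̄' > 0`, so `x̄` serves as time.
After a rescaling of this time to `[0, 1]` the trajectories are the solutions of an integral
equation `h = ∫₁ᵗ q` for `h ∈ C([0, 1])` together with one equation for each endpoint. The
equation for `h` decouples at `z = 0`, because `r` and `ρ` vanish there, and the implicit function
theorem in this Banach space yields a family of trajectories of class `C²` in `z`
(`exists_smooth_trajectories`, `flowsTo_of_integral_equation`), hence a transition factor of class
`C²` (`exists_smooth_transitionFactor`).

On the axis the reflection `x̄ ↦ -x̄` reverses the sign of `g` and exchanges the sections, so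
`F(0, 0) = 1`. Consequently `S(ρ) = ρ F(0, ρ)` has the second derivative `2 F_ρ(0, 0)` at `0`, and
the inverse factor gives the opposite value. The derivative of `log F` is a sum of two terms
(`hasDerivAt_log_factor`): one from the first variation of `g / x̄'` along the axis, which is
`μ̄₃` times `variationIntegral`, and one from the slopes `dx̄/dρ` of the two sections where they
meet the axis.

The slopes have to be found without knowing the charts. On the axis the normal form is a linear
equation for the chart, which the normalization at the singular point solves uniquely:
`x̄ᵢ = (β² - x̄²) / (2β)` (`IsNormalizingChart.axis_equations`). In particular the section at height `X₀`
meets the axis at `x̄ = ± axisPt B X₀`. The part of the chart that is linear in `ρ` satisfies a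
linear equation with a singularity at the singular point. Regularity there excludes the solutions
of the homogeneous equation, unless `σ₀ = 1`, where the resonant term and the additional
normalization come in. In both cases `singular_linear_solution` provides an integral formula for
the slope (`sectionTilt`, `IsNormalizingChart.fderiv_rho`). The slope is proportional to `μ̄₃` and
the same for both sections, by the symmetry of the axis equations under `x̄ ↦ -x̄`.

The resulting coefficient `transitionCoeff` depends continuously on `B`, and it is nonzero at
`B₀`. If `σ₀ ≠ 1`, an integration by parts turns it into a sum of terms of the same sign
(`transitionCoeff_ne_zero_of_ratio_ne_one`); if `σ₀ = 1`, it can be computed well enough to see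
that a logarithm dominates for small `X₀` (`transitionCoeff_ne_zero_of_ratio_eq_one`).

It remains to compare an arbitrary transition factor with the one constructed. On `r = 0` both
transitions start from the same points of `Σ₄`, so two points of `Σ₃` would lie on one trajectory
if the factors differed. That is impossible: near the axis a trajectory that leaves the graph `Σ₃`
stays to the right of it (`eq_of_flowsTo_of_graph`, `IsTransitionFactor.eventually_eq`).
-/

open Set Filter Topology

noncomputable section

namespace NilpotentBlowUp

/-! ### Second derivatives at a point -/

theorem HasSecondDerivAt.congr {S R : ℝ → ℝ} {l a : ℝ} (h : HasSecondDerivAt S l a)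
    (e : R =ᶠ[𝓝 a] S) : HasSecondDerivAt R l a := by
  refine ⟨?_, h.2.congr_of_eventuallyEq e.deriv⟩
  filter_upwards [h.1, e.eventuallyEq_nhds] with x hx hxe
  exact hx.congr_of_eventuallyEq hxe

theorem hasSecondDerivAt_id_mul {f : ℝ → ℝ} {l : ℝ} (hf : ContDiffAt ℝ 2 f 0)
    (hl : HasDerivAt f l 0) : HasSecondDerivAt (fun ρ => ρ * f ρ) (2 * l) 0 := by
  have hev : ∀ᶠ x in 𝓝 (0 : ℝ), DifferentiableAt ℝ f x :=
    (hf.eventually (by simp)).mono fun x hx => hx.differentiableAt (by simp)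
  have hd : DifferentiableAt ℝ (deriv f) 0 :=
    ((hf.fderiv_right (m := 1) (by norm_num)).clm_apply
      contDiffAt_const).differentiableAt (by simp)
  refine ⟨hev.mono fun x hx => differentiableAt_id.mul hx, ?_⟩
  have heq : deriv (fun ρ => ρ * f ρ) =ᶠ[𝓝 0] fun ρ => f ρ + ρ * deriv f ρ := by
    filter_upwards [hev] with x hx
    simpa using ((hasDerivAt_id' x).fun_mul hx.hasDerivAt).deriv
  refine ((hl.fun_add ((hasDerivAt_id' (0 : ℝ)).fun_mul hd.hasDerivAt)).congr_of_eventuallyEq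
    heq).congr_deriv ?_
  rw [hl.deriv]
  ring

/-! ### The Banach algebra of continuous functions on the unit interval -/

/-- Continuous functions on the unit interval, with the sup norm. -/
abbrev CurveSpace : Type := C(Icc (0 : ℝ) 1, ℝ)

/-- The operator `f ↦ (t ↦ ∫₁ᵗ f)` on continuous functions on the unit interval. -/
def volterra : CurveSpace →L[ℝ] CurveSpace :=
  LinearMap.mkContinuous
    { toFun := fun f => ⟨fun t => ∫ s in (1 : ℝ)..t, IccExtend zero_le_one f s, by
        have h : Continuous fun t : ℝ => ∫ s in (1 : ℝ)..t, IccExtend zero_le_one f s :=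
          intervalIntegral.continuous_primitive
            (fun a b => (f.continuous.Icc_extend' (h := zero_le_one)).intervalIntegrable a b) 1
        exact h.comp continuous_subtype_val⟩
      map_add' := fun f g => by
        ext t
        exact intervalIntegral.integral_add
          ((f.continuous.Icc_extend' (h := zero_le_one)).intervalIntegrable _ _)
          ((g.continuous.Icc_extend' (h := zero_le_one)).intervalIntegrable _ _)
      map_smul' := fun c f => by
        ext t
        exact intervalIntegral.integral_const_mul c _ }
    1 fun f => by
      rw [one_mul, ContinuousMap.norm_le _ (norm_nonneg f)]
      intro t
      refine (intervalIntegral.norm_integral_le_of_norm_le_const (C := ‖f‖) fun s _ =>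
        f.norm_coe_le_norm _).trans ?_
      have h : |(t : ℝ) - 1| ≤ 1 := by
        rw [abs_le]
        constructor <;> linarith [t.2.1, t.2.2]
      nlinarith [norm_nonneg f]

theorem volterra_apply (f : CurveSpace) (t : Icc (0 : ℝ) 1) :
    volterra f t = ∫ s in (1 : ℝ)..t, IccExtend zero_le_one f s := rfl

theorem curveSpace_exp_apply (f : CurveSpace) (t : Icc (0 : ℝ) 1) :
    NormedSpace.exp f t = Real.exp (f t) := by
  rw [Real.exp_eq_exp_ℝ]
  exact NormedSpace.map_exp (ContinuousMap.evalAlgHom ℝ ℝ t)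
    (continuous_eval_const t) f

theorem contDiff_curveSpace_exp {n : WithTop ℕ∞} :
    ContDiff ℝ n (NormedSpace.exp : CurveSpace → CurveSpace) :=
  contDiff_iff_contDiffAt.2 fun f => (NormedSpace.exp_analytic (𝕂 := ℝ) f).contDiffAt

theorem curveSpace_inverse_apply {f : CurveSpace} (hf : ∀ t, f t ≠ 0) (t : Icc (0 : ℝ) 1) :
    Ring.inverse f t = (f t)⁻¹ := by
  have h := Ring.mul_inverse_cancel f ((ContinuousMap.isUnit_iff_forall_ne_zero f).2 hf)
  have h' := congrArg (fun k : CurveSpace => k t) h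
  exact eq_inv_of_mul_eq_one_right h'

theorem contDiffAt_curveSpace_inverse {n : WithTop ℕ∞} {f : CurveSpace} (hf : ∀ t, f t ≠ 0) :
    ContDiffAt ℝ n (Ring.inverse : CurveSpace → CurveSpace) f := by
  obtain ⟨v, rfl⟩ := (ContinuousMap.isUnit_iff_forall_ne_zero f).2 hf
  exact contDiffAt_ringInverse ℝ v

/-- The superposition operator of `f : ℝ³ → ℝ` on curves in `ℝ³` is of class `C²`. -/
def SmoothLift (f : ℝ × ℝ × ℝ → ℝ) : Prop :=
  ∃ L : CurveSpace × CurveSpace × CurveSpace → CurveSpace, ContDiff ℝ 2 L ∧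
    ∀ p t, L p t = f (p.1 t, p.2.1 t, p.2.2 t)

namespace SmoothLift

theorem const (c : ℝ) : SmoothLift fun _ => c :=
  ⟨fun _ => ContinuousMap.const _ c, contDiff_const, fun _ _ => rfl⟩

theorem r : SmoothLift fun p => p.1 := ⟨fun p => p.1, contDiff_fst, fun _ _ => rfl⟩

theorem ρ : SmoothLift fun p => p.2.1 := ⟨fun p => p.2.1, by fun_prop, fun _ _ => rfl⟩

theorem x : SmoothLift fun p => p.2.2 := ⟨fun p => p.2.2, by fun_prop, fun _ _ => rfl⟩

theorem add {f g : ℝ × ℝ × ℝ → ℝ} (hf : SmoothLift f) (hg : SmoothLift g) :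
    SmoothLift fun p => f p + g p := by
  obtain ⟨F, hF, hf⟩ := hf
  obtain ⟨G, hG, hg⟩ := hg
  exact ⟨fun p => F p + G p, hF.add hG, fun p t => by simp [hf, hg]⟩

theorem sub {f g : ℝ × ℝ × ℝ → ℝ} (hf : SmoothLift f) (hg : SmoothLift g) :
    SmoothLift fun p => f p - g p := by
  obtain ⟨F, hF, hf⟩ := hf
  obtain ⟨G, hG, hg⟩ := hg
  exact ⟨fun p => F p - G p, hF.sub hG, fun p t => by simp [hf, hg]⟩

theorem mul {f g : ℝ × ℝ × ℝ → ℝ} (hf : SmoothLift f) (hg : SmoothLift g) :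
    SmoothLift fun p => f p * g p := by
  obtain ⟨F, hF, hf⟩ := hf
  obtain ⟨G, hG, hg⟩ := hg
  exact ⟨fun p => F p * G p, hF.mul hG, fun p t => by simp [hf, hg]⟩

theorem pow {f : ℝ × ℝ × ℝ → ℝ} (hf : SmoothLift f) (n : ℕ) :
    SmoothLift fun p => f p ^ n := by
  obtain ⟨F, hF, hf⟩ := hf
  exact ⟨fun p => F p ^ n, hF.pow n, fun p t => by simp [hf]⟩

end SmoothLift

/-! ### The components of the blown-up field -/

/-- The component `x̄'` of the blown-up field. -/
def xRate (u : Unfolding) (A : Params) (p : ℝ × ℝ × ℝ) : ℝ := (blowUpField u A p).2.2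

theorem blowUpField_eq (u : Unfolding) (A : Params) (p : ℝ × ℝ × ℝ) :
    blowUpField u A p = (p.1 * rate u A p, -p.2.1 * rate u A p, xRate u A p) := rfl

theorem smoothLift_rate (u : Unfolding) (A : Params) : SmoothLift (rate u A) := by
  have r := SmoothLift.r
  have ρ := SmoothLift.ρ
  have x := SmoothLift.x
  cases u
  · exact ((x.sub ((SmoothLift.const _).mul ρ)).sub ((SmoothLift.const _).mul r)).add
      ((r.pow 2).mul x)
  · exact ((x.sub ((SmoothLift.const _).mul ρ)).add ((r.pow 2).mul x)).sub
      (((SmoothLift.const _).mul r).mul (x.pow 2))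

theorem smoothLift_xRate (u : Unfolding) (A : Params) : SmoothLift (xRate u A) := by
  have r := SmoothLift.r
  have ρ := SmoothLift.ρ
  have x := SmoothLift.x
  have c := SmoothLift.const
  refine SmoothLift.sub (f := fun p => _) (g := fun p => p.2.2 * rate u A p) ?_
    (x.mul (smoothLift_rate u A))
  cases u
  · exact (c 2).mul ((((((c 1).add ((c _).mul (x.pow 2))).sub ((c _).mul (ρ.pow 2))).sub
      (((c _).mul ρ).mul x)).add (((c _).mul r).mul x)).add ((r.pow 2).mul (x.pow 2)))
  · exact (c 2).mul (((((((c 1).add ((c _).mul (x.pow 2))).sub ((c _).mul (ρ.pow 2))).sub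
      (((c _).mul ρ).mul x)).add (((c _).mul r).mul x)).add ((r.pow 2).mul (x.pow 2))).sub
        (((c _).mul r).mul (x.pow 3)))

theorem contDiff_rate (u : Unfolding) (A : Params) {n : WithTop ℕ∞} : ContDiff ℝ n (rate u A) := by
  unfold rate
  cases u <;> fun_prop

theorem contDiff_blowUpField (u : Unfolding) (A : Params) {n : WithTop ℕ∞} :
    ContDiff ℝ n (blowUpField u A) := by
  have h := contDiff_rate u A (n := n)
  unfold blowUpField
  cases u <;> fun_prop

theorem contDiff_xRate (u : Unfolding) (A : Params) {n : WithTop ℕ∞} :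
    ContDiff ℝ n (xRate u A) := by
  have h := contDiff_blowUpField u A (n := n)
  unfold xRate
  fun_prop

theorem rate_plane (u : Unfolding) (A : Params) (ρ x : ℝ) :
    rate u A (0, ρ, x) = x - A.mu3 * ρ := by
  cases u <;> simp [rate]

theorem xRate_plane (u : Unfolding) (A : Params) (ρ x : ℝ) :
    xRate u A (0, ρ, x) =
      2 + (1 - 2 * A.B) * x ^ 2 - 2 * A.mu2 * ρ ^ 2 - A.mu3 * x * ρ := by
  cases u <;> simp [xRate, blowUpField, rate] <;> ring

/-! ### Trajectories -/

/-- A solution of a scalar linear equation `y' = y c(t)` is its initial value times a positive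
function. -/
theorem exists_pos_eq_mul_of_hasDerivWithinAt {y c : ℝ → ℝ} {T : ℝ} (hT : 0 ≤ T)
    (hc : ContinuousOn c (Icc 0 T))
    (hy : ∀ t ∈ Icc 0 T, HasDerivWithinAt y (y t * c t) (Icc 0 T) t) :
    ∃ E : ℝ → ℝ, (∀ t, 0 < E t) ∧ ∀ t ∈ Icc 0 T, y t = y 0 * E t := by
  have hc' : Continuous (IccExtend hT ((Icc 0 T).domRestrict c)) :=
    (continuousOn_iff_continuous_domRestrict.1 hc).Icc_extend'
  have hP : ∀ t, HasDerivAt (fun t => ∫ s in (0 : ℝ)..t, IccExtend hT ((Icc 0 T).domRestrict c) s)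
      (IccExtend hT ((Icc 0 T).domRestrict c) t) t := fun t =>
    (hc'.integral_hasStrictDerivAt 0 t).hasDerivAt
  set P : ℝ → ℝ := fun t => ∫ s in (0 : ℝ)..t, IccExtend hT ((Icc 0 T).domRestrict c) s with hPdef
  refine ⟨fun t => Real.exp (P t), fun t => Real.exp_pos _, ?_⟩
  have hz : ∀ t ∈ Icc 0 T, HasDerivWithinAt (fun t => y t * Real.exp (-P t)) 0 (Icc 0 T) t := by
    intro t ht
    have h := (hy t ht).fun_mul (hP t).fun_neg.exp.hasDerivWithinAt
    refine h.congr_deriv ?_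
    rw [IccExtend_of_mem hT _ ht]
    simp only [domRestrict_apply]
    ring
  intro t ht
  have h := constant_of_derivWithin_zero (fun t ht => (hz t ht).differentiableWithinAt)
    (fun t ht => (hz t (Ico_subset_Icc_self ht)).derivWithin
      (uniqueDiffOn_Icc (ht.1.trans_lt ht.2) t (Ico_subset_Icc_self ht))) t ht
  have hP0 : P 0 = 0 := by simp [hPdef]
  simp only [hP0, neg_zero, Real.exp_zero, mul_one] at h
  rw [← h, mul_assoc, ← Real.exp_add]
  simp

theorem isIntegralCurveOn_eqOn {X : ℝ × ℝ × ℝ → ℝ × ℝ × ℝ} (hX : ContDiff ℝ 1 X)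
    {γ γ' : ℝ → ℝ × ℝ × ℝ} {T : ℝ} (h0 : γ 0 = γ' 0)
    (hγ : IsIntegralCurveOn γ (fun _ => X) (Icc 0 T))
    (hγ' : IsIntegralCurveOn γ' (fun _ => X) (Icc 0 T)) : EqOn γ γ' (Icc 0 T) := by
  obtain ⟨R, hR⟩ := ((isCompact_Icc.image_of_continuousOn hγ.continuousOn).union
    (isCompact_Icc.image_of_continuousOn hγ'.continuousOn)).isBounded.subset_closedBall 0
  obtain ⟨K, hK⟩ := hX.contDiffOn.exists_lipschitzOnWith (s := Metric.closedBall 0 R) (by simp)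
    (convex_closedBall _ _) (isCompact_closedBall _ _)
  have key : ∀ {γ : ℝ → ℝ × ℝ × ℝ}, IsIntegralCurveOn γ (fun _ => X) (Icc 0 T) →
      ∀ t ∈ Ico 0 T, HasDerivWithinAt γ (X (γ t)) (Ici t) t := fun h t ht =>
    (h t (Ico_subset_Icc_self ht)).mono_of_mem_nhdsWithin
      (mem_of_superset (Icc_mem_nhdsGE ht.2) (Icc_subset_Icc_left ht.1))
  exact ODE_solution_unique_of_mem_Icc_right (v := fun _ => X)
    (s := fun _ => Metric.closedBall 0 R) (K := K) (fun _ _ => hK) hγ.continuousOn (key hγ)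
    (fun t ht => hR (Or.inl (mem_image_of_mem _ (Ico_subset_Icc_self ht)))) hγ'.continuousOn
    (key hγ') (fun t ht => hR (Or.inr (mem_image_of_mem _ (Ico_subset_Icc_self ht)))) h0

theorem isIntegralCurveOn_shift {X : ℝ × ℝ × ℝ → ℝ × ℝ × ℝ} {γ : ℝ → ℝ × ℝ × ℝ} {T t₀ : ℝ}
    (ht₀ : 0 ≤ t₀) (hγ : IsIntegralCurveOn γ (fun _ => X) (Icc 0 T)) :
    IsIntegralCurveOn (fun t => γ (t + t₀)) (fun _ => X) (Icc 0 (T - t₀)) := by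
  intro t ht
  have h := (hγ (t + t₀) ⟨by linarith [ht.1], by linarith [ht.2]⟩).scomp t
    ((hasDerivWithinAt_id t (Icc 0 (T - t₀))).add_const t₀)
    (fun s (hs : s ∈ Icc 0 (T - t₀)) => (⟨by simpa using add_nonneg hs.1 ht₀,
      by simpa [le_sub_iff_add_le] using hs.2⟩ : id s + t₀ ∈ Icc 0 T))
  simpa using! h

/-- Of two points reached from the same point, one is reached from the other. -/
theorem FlowsTo.total {X : ℝ × ℝ × ℝ → ℝ × ℝ × ℝ} (hX : ContDiff ℝ 1 X) {a b c : ℝ × ℝ × ℝ}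
    (hb : FlowsTo X a b) (hc : FlowsTo X a c) : FlowsTo X b c ∨ FlowsTo X c b := by
  obtain ⟨T, γ, hT, h0, hTb, hγ⟩ := hb
  obtain ⟨T', γ', hT', h0', hTc, hγ'⟩ := hc
  rcases le_total T T' with h | h
  · left
    have e := isIntegralCurveOn_eqOn hX (h0.trans h0'.symm) hγ
      (hγ'.mono (Icc_subset_Icc_right h)) (right_mem_Icc.2 hT)
    exact ⟨T' - T, fun t => γ' (t + T), sub_nonneg.2 h, by simp [← e, hTb], by simp [hTc],
      isIntegralCurveOn_shift hT hγ'⟩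
  · right
    have e := isIntegralCurveOn_eqOn hX (h0'.trans h0.symm) hγ'
      (hγ.mono (Icc_subset_Icc_right h)) (right_mem_Icc.2 hT')
    exact ⟨T - T', fun t => γ (t + T'), sub_nonneg.2 h, by simp [← e, hTc], by simp [hTb],
      isIntegralCurveOn_shift hT' hγ⟩

/-! ### The axis `r = ρ = 0` -/

/-- The singular points on the axis are `x̄ = ± β`. -/
def beta (B : ℝ) : ℝ := √(2 / (2 * B - 1))

/-- The restriction of `x̄'` to the axis. -/
def axisRate (B x : ℝ) : ℝ := (2 * B - 1) * (beta B ^ 2 - x ^ 2)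

/-- The sections at height `X₀` meet the axis at `x̄ = ± axisPt B X₀`. -/
def axisPt (B X₀ : ℝ) : ℝ := √(beta B ^ 2 - 2 * beta B * X₀)

/-- The factor by which `ρ` is multiplied, to first order, along the axis between `axisPt B X₀` and
`x`. -/
def weight (B X₀ x : ℝ) : ℝ := ((beta B ^ 2 - x ^ 2) / (2 * beta B * X₀)) ^ (1 / ratio B)

section Axis

variable {B X₀ : ℝ}

theorem beta_pos (hB : 1 / 2 < B) : 0 < beta B :=
  Real.sqrt_pos.2 (div_pos two_pos (by linarith))

theorem beta_sq (hB : 1 / 2 < B) : (2 * B - 1) * beta B ^ 2 = 2 := by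
  have h : 0 < 2 * B - 1 := by linarith
  rw [beta, Real.sq_sqrt (div_pos two_pos h).le]
  field_simp

theorem ratio_pos (hB : 1 / 2 < B) : 0 < ratio B := by
  unfold ratio
  linarith

theorem axisRate_eq (hB : 1 / 2 < B) (x : ℝ) : axisRate B x = 2 + (1 - 2 * B) * x ^ 2 := by
  unfold axisRate
  linear_combination beta_sq hB

theorem xRate_axis (hB : 1 / 2 < B) (u : Unfolding) {A : Params} (hA : A.B = B) (x : ℝ) :
    xRate u A (0, 0, x) = axisRate B x := by
  rw [xRate_plane, axisRate_eq hB, hA]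
  ring

theorem hasDerivAt_axisRate (B x : ℝ) : HasDerivAt (axisRate B) (-(ratio B * x)) x := by
  refine ((((hasDerivAt_pow 2 x).const_sub (beta B ^ 2)).const_mul (2 * B - 1))).congr_deriv ?_
  simp [ratio]
  ring

theorem axisRate_pos (hB : 1 / 2 < B) {x : ℝ} (hx : |x| < beta B) : 0 < axisRate B x := by
  have h := sq_lt_sq' (neg_lt_of_abs_lt hx) (lt_of_abs_lt hx)
  exact mul_pos (by linarith) (by linarith)

theorem axisRate_neg (B x : ℝ) : axisRate B (-x) = axisRate B x := by simp [axisRate]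

theorem weight_neg (B X₀ x : ℝ) : weight B X₀ (-x) = weight B X₀ x := by simp [weight]

theorem axisPt_sq (h : 2 * X₀ < beta B) (hβ : 0 < beta B) :
    axisPt B X₀ ^ 2 = beta B ^ 2 - 2 * beta B * X₀ :=
  Real.sq_sqrt (by nlinarith)

theorem axisPt_pos (h : 2 * X₀ < beta B) (hβ : 0 < beta B) : 0 < axisPt B X₀ :=
  Real.sqrt_pos.2 (by nlinarith)

theorem axisPt_lt (hX : 0 < X₀) (hβ : 0 < beta B) : axisPt B X₀ < beta B :=
  (Real.sqrt_lt' hβ).2 (by nlinarith)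

theorem axisRate_axisPt (h : 2 * X₀ < beta B) (hβ : 0 < beta B) :
    axisRate B (axisPt B X₀) = ratio B * beta B * X₀ := by
  rw [axisRate, axisPt_sq h hβ, ratio]
  ring

theorem weight_axisPt (hX : 0 < X₀) (h : 2 * X₀ < beta B) (hβ : 0 < beta B) :
    weight B X₀ (axisPt B X₀) = 1 := by
  rw [weight, axisPt_sq h hβ, sub_sub_cancel, div_self (by positivity), Real.one_rpow]

theorem weight_beta (hB : 1 / 2 < B) : weight B X₀ (beta B) = 0 := by
  rw [weight, sub_self, zero_div, Real.zero_rpow (one_div_pos.2 (ratio_pos hB)).ne']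

theorem continuous_weight (hB : 1 / 2 < B) : Continuous (weight B X₀) := by
  have h := ratio_pos hB
  unfold weight
  exact (by fun_prop : Continuous fun x => (beta B ^ 2 - x ^ 2) / (2 * beta B * X₀)).rpow_const
    fun _ => Or.inr (one_div_pos.2 h).le

theorem hasDerivAt_weight (hB : 1 / 2 < B) (hX : 0 < X₀) {x : ℝ} (hx : |x| < beta B) :
    HasDerivAt (weight B X₀) (-(x / axisRate B x * weight B X₀ x)) x := by
  have hβ := beta_pos hB
  have hσ := ratio_pos hB
  have hu : 0 < beta B ^ 2 - x ^ 2 := by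
    linarith [sq_lt_sq' (neg_lt_of_abs_lt hx) (lt_of_abs_lt hx)]
  have hτ : 0 < 2 * B - 1 := by linarith
  have hq : 0 < (beta B ^ 2 - x ^ 2) / (2 * beta B * X₀) := by positivity
  have h := (((hasDerivAt_pow 2 x).const_sub (beta B ^ 2)).div_const
    (2 * beta B * X₀)).rpow_const (p := 1 / ratio B) (Or.inl hq.ne')
  refine h.congr_deriv ?_
  rw [Real.rpow_sub_one hq.ne', weight, axisRate]
  simp only [ratio]
  field_simp
  ring

end Axis

/-- The singular linear equation `D Z' + (σ - 1) x Z = D x m` has at most one solution that is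
differentiable up to the singular point `β` and vanishes there; multiplied by the weight, it is an
integral. -/
theorem singular_linear_solution {B X₀ : ℝ} (hB : 1 / 2 < B) (hX : 0 < X₀)
    (hX' : 2 * X₀ < beta B) {Z Z' m m' : ℝ → ℝ}
    (hZ : ∀ y ∈ Icc (axisPt B X₀) (beta B), HasDerivAt Z (Z' y) y) (hZβ : Z (beta B) = 0)
    (hm : ∀ y ∈ Icc (axisPt B X₀) (beta B), HasDerivAt m (m' y) y)
    (hm' : ContinuousOn m' (Icc (axisPt B X₀) (beta B)))
    (hode : ∀ y ∈ Icc (axisPt B X₀) (beta B),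
      axisRate B y * Z' y + (ratio B - 1) * y * Z y = axisRate B y * (y * m y)) :
    Z (axisPt B X₀) / axisRate B (axisPt B X₀) =
      -m (axisPt B X₀) - ∫ y in axisPt B X₀..beta B, weight B X₀ y * m' y := by
  have hβ := beta_pos hB
  have ha := axisPt_pos hX' hβ
  have hab := axisPt_lt hX hβ
  set a := axisPt B X₀ with ha_def
  have hτ : 0 < 2 * B - 1 := by linarith
  -- The product `weight * (Z / D + m)`, written so that it is continuous at `β`.
  set f : ℝ → ℝ := fun y =>
    weight B X₀ y * (m y - dslope Z (beta B) y / ((2 * B - 1) * (beta B + y))) with hf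
  have hfeq : ∀ y, y ≠ beta B → dslope Z (beta B) y = Z y / (y - beta B) := fun y hy => by
    rw [dslope_of_ne _ hy, slope_def_field, hZβ, sub_zero]
  have hquot : ∀ y ∈ Ico a (beta B),
      -(dslope Z (beta B) y / ((2 * B - 1) * (beta B + y))) = Z y / axisRate B y := fun y hy => by
    have h1 : y - beta B ≠ 0 := (sub_neg.2 hy.2).ne
    have h2 : beta B + y ≠ 0 := by linarith [hy.1]
    have h3 : beta B ^ 2 - y ^ 2 ≠ 0 := by
      rw [sq_sub_sq]
      exact mul_ne_zero h2 (sub_pos.2 hy.2).ne'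
    rw [hfeq y hy.2.ne, axisRate]
    field_simp
    ring
  have hcont : ContinuousOn f (Icc a (beta B)) := by
    have hd : ContinuousOn (dslope Z (beta B)) (Icc a (beta B)) := fun y hy => by
      refine ContinuousAt.continuousWithinAt ?_
      rcases eq_or_ne y (beta B) with rfl | hne
      · exact continuousAt_dslope_same.2 (hZ _ hy).differentiableAt
      · exact (continuousAt_dslope_of_ne hne).2 (hZ y hy).continuousAt
    refine (continuous_weight hB).continuousOn.mul (ContinuousOn.sub
      (fun y hy => (hm y hy).continuousAt.continuousWithinAt) (hd.div (by fun_prop) ?_))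
    intro y hy
    have : 0 < beta B + y := by linarith [hy.1]
    positivity
  have hderiv : ∀ y ∈ Ioo a (beta B), HasDerivAt f (weight B X₀ y * m' y) y := by
    intro y hy
    have hyI : y ∈ Icc a (beta B) := Ioo_subset_Icc_self hy
    have hy' : |y| < beta B := by rw [abs_of_pos (ha.trans hy.1)]; exact hy.2
    have hD := axisRate_pos hB hy'
    have h := (hasDerivAt_weight hB hX hy').fun_mul
      (((hZ y hyI).fun_div (hasDerivAt_axisRate B y) hD.ne').fun_add (hm y hyI))
    refine (h.congr_of_eventuallyEq ?_).congr_deriv ?_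
    · filter_upwards [Ioo_mem_nhds hy.1 hy.2] with t ht
      rw [hf, ← hquot t (Ioo_subset_Ico_self ht)]
      ring
    · have e := hode y hyI
      have e' : Z' y = y * m y - (ratio B - 1) * y * Z y / axisRate B y := by
        field_simp
        linarith
      rw [e']
      field_simp
      ring
  have hint := intervalIntegral.integral_eq_sub_of_hasDerivAt_of_le hab.le hcont hderiv
    (((continuous_weight hB).continuousOn.mul hm').intervalIntegrable_of_Icc hab.le)
  have hfb : f (beta B) = 0 := by rw [hf]; simp [weight_beta hB]
  have hfa : f a = m a + Z a / axisRate B a := by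
    rw [hf, ← hquot a ⟨le_rfl, hab⟩]
    simp only [ha_def, weight_axisPt hX hX' hβ]
    ring
  rw [hint, hfb, hfa]
  ring

/-! ### Normalizing charts along the axis -/

theorem mem_chart_ball {B s e r ρ x : ℝ} :
    (r, ρ, x) ∈ Metric.ball (singularPt B s) e ↔ |r| < e ∧ |ρ| < e ∧ |x - s * beta B| < e := by
  simp [singularPt, beta, Prod.dist_eq, Real.dist_eq]

/-- On the plane `r = 0` the normal form is linear in `G` with a forcing term depending on `ρ`, the
linear part of which vanishes unless the eigenvalue ratio is `1`. -/
theorem NormalFormTerms.plane {σ₀ : ℝ} {p q : ℕ} {η : Polynomial ℝ} {Φ : MvPolynomial (Fin 2) ℝ}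
    (h : NormalFormTerms σ₀ p q η Φ) (σ : ℝ) (φ : Polynomial ℝ) :
    ∃ (ζ : ℝ → ℝ) (η₁ : ℝ), ζ 0 = 0 ∧ HasDerivAt ζ η₁ 0 ∧ (σ₀ ≠ 1 → η₁ = 0) ∧
      ∀ ρ Y, normalFormRHS σ p q φ η Φ 0 ρ Y = -(σ + φ.eval 0) * Y + ζ ρ := by
  rcases h with ⟨-, hΦ, hη⟩ | ⟨hp, hq, hpq, hσ, hΦ, hη⟩
  · exact ⟨fun _ => 0, 0, rfl, hasDerivAt_const _ _, fun _ => rfl, fun ρ Y => by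
      simp [normalFormRHS, hΦ, hη]⟩
  · refine ⟨fun ρ => ρ ^ p * η.eval 0, p * 0 ^ (p - 1) * η.eval 0, by simp [hp.ne'],
      (hasDerivAt_pow p 0).mul_const _, fun h1 => ?_, fun ρ Y => ?_⟩
    · by_cases hq1 : q = 1
      · have hp1 : p ≠ 1 := by
          rintro rfl
          exact h1 (by simp [hσ, hq1])
        have : p - 1 ≠ 0 := by omega
        simp [this]
      · simp [hη hq1]
    · simp [normalFormRHS, hp.ne', hΦ]

section Chart

variable {u : Unfolding} {B₀ : ℝ} {A : Params} {s : ℝ} {k : ℕ} {e : ℝ} {G : ℝ × ℝ × ℝ → ℝ}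

theorem mem_chart_ball_axis {B s e y : ℝ} (hs : s * s = 1) (he : 0 < e) :
    ((0 : ℝ), (0 : ℝ), s * y) ∈ Metric.ball (singularPt B s) e ↔ |y - beta B| < e := by
  have hs' : |s| = 1 := by
    rcases mul_self_eq_one_iff.1 hs with rfl | rfl <;> simp
  rw [mem_chart_ball, ← mul_sub, abs_mul, hs', one_mul]
  simp [he]

theorem IsNormalizingChart.pos_of_mem (h : IsNormalizingChart u B₀ A s k e G) (hs : s * s = 1)
    (hB : 1 / 2 < A.B) {y : ℝ} (hy : |y - beta A.B| < e) : 0 < y := by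
  by_contra! hy0
  have hβ := beta_pos hB
  have h0 : |0 - beta A.B| < e := by
    rw [abs_lt] at hy ⊢
    constructor <;> linarith [hy.1, h.pos]
  refine h.rate_ne_zero _ ((mem_chart_ball_axis hs h.pos).2 h0) ?_
  rw [rate_plane]
  ring

theorem IsNormalizingChart.contDiffAt (h : IsNormalizingChart u B₀ A s k e G) (hk : 2 ≤ k)
    {z : ℝ × ℝ × ℝ} (hz : z ∈ Metric.ball (singularPt A.B s) e) : ContDiffAt ℝ 2 G z :=
  (h.contDiffOn.contDiffAt (Metric.isOpen_ball.mem_nhds hz)).of_le (by exact_mod_cast hk)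

/-- On the plane `r = 0` the normal form reads
`-ρ g G_ρ + Q G_x = g (-(σ + φ₀) G + ζ(ρ))`, with a forcing term `ζ` that has no linear part unless
the eigenvalue ratio is `1`. -/
theorem IsNormalizingChart.plane_equation (h : IsNormalizingChart u B₀ A s k e G)
    (hs : s * s = 1) :
    ∃ (φ₀ : ℝ) (ζ : ℝ → ℝ) (η₁ : ℝ), ζ 0 = 0 ∧ HasDerivAt ζ η₁ 0 ∧ (ratio B₀ ≠ 1 → η₁ = 0) ∧
      ∀ y, |y - beta A.B| < e → ∀ᶠ ρ in 𝓝 (0 : ℝ),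
        -ρ * (s * y - A.mu3 * ρ) * fderiv ℝ G (0, ρ, s * y) (0, 1, 0) +
          xRate u A (0, ρ, s * y) * fderiv ℝ G (0, ρ, s * y) (0, 0, 1) =
        (s * y - A.mu3 * ρ) * (-(ratio A.B + φ₀) * G (0, ρ, s * y) + ζ ρ) := by
  obtain ⟨p, q, φ, η, Φ, hterms, hnf⟩ := h.normalForm
  obtain ⟨ζ, η₁, hζ0, hζ, hη₁, hRHS⟩ := hterms.plane (ratio A.B) φ
  refine ⟨φ.eval 0, ζ, η₁, hζ0, hζ, hη₁, fun y hy => ?_⟩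
  have hc : Continuous fun ρ : ℝ => ((0 : ℝ), ρ, s * y) := by fun_prop
  filter_upwards [hc.continuousAt.preimage_mem_nhds
    (Metric.isOpen_ball.mem_nhds ((mem_chart_ball_axis hs h.pos).2 hy))] with ρ hρ
  have h1 := hnf _ hρ
  rw [hRHS, blowUpField_eq, rate_plane] at h1
  rw [← h1]
  have : ((0 : ℝ) * (s * y - A.mu3 * ρ), -ρ * (s * y - A.mu3 * ρ), xRate u A (0, ρ, s * y)) =
      (-ρ * (s * y - A.mu3 * ρ)) • ((0 : ℝ), (1 : ℝ), (0 : ℝ)) +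
        xRate u A (0, ρ, s * y) • ((0 : ℝ), (0 : ℝ), (1 : ℝ)) := by
    ext <;> simp
  rw [this, map_add, map_smul, map_smul, smul_eq_mul, smul_eq_mul]

theorem hasDerivAt_axis_curve (s y : ℝ) :
    HasDerivAt (fun y => ((0 : ℝ), (0 : ℝ), s * y)) (s • (0, 0, 1)) y :=
  ((hasDerivAt_const y (0 : ℝ)).prodMk ((hasDerivAt_const y (0 : ℝ)).prodMk
    ((hasDerivAt_id' y).const_mul s))).congr_deriv (by simp)

theorem hasDerivAt_rho_line (y : ℝ) :
    HasDerivAt (fun ρ : ℝ => ((0 : ℝ), ρ, y)) (0, 1, 0) 0 :=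
  (hasDerivAt_const _ (0 : ℝ)).prodMk ((hasDerivAt_id' (0 : ℝ)).prodMk (hasDerivAt_const _ _))

theorem hasDerivAt_comp_axis {y : ℝ} (hG : ContDiffAt ℝ 2 G (0, 0, s * y)) :
    HasDerivAt (fun y => G (0, 0, s * y)) (s * fderiv ℝ G (0, 0, s * y) (0, 0, 1)) y :=
  ((hG.differentiableAt (by simp)).hasFDerivAt.comp_hasDerivAt y
    (hasDerivAt_axis_curve s y)).congr_deriv (by rw [map_smul, smul_eq_mul])

theorem hasFDerivAt_fderiv {z : ℝ × ℝ × ℝ} (hG : ContDiffAt ℝ 2 G z) :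
    HasFDerivAt (fderiv ℝ G) (fderiv ℝ (fderiv ℝ G) z) z :=
  ((hG.fderiv_right (m := 1) (by norm_num)).differentiableAt (by simp)).hasFDerivAt

theorem hasFDerivAt_fderiv_apply {z : ℝ × ℝ × ℝ} (hG : ContDiffAt ℝ 2 G z) (v : ℝ × ℝ × ℝ) :
    HasFDerivAt (fun z => fderiv ℝ G z v)
      ((ContinuousLinearMap.apply ℝ ℝ v).comp (fderiv ℝ (fderiv ℝ G) z)) z :=
  (ContinuousLinearMap.apply ℝ ℝ v).hasFDerivAt.comp z (hasFDerivAt_fderiv hG)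

theorem hasDerivAt_fderiv_axis {y : ℝ} (hG : ContDiffAt ℝ 2 G (0, 0, s * y)) (v : ℝ × ℝ × ℝ) :
    HasDerivAt (fun y => fderiv ℝ G (0, 0, s * y) v)
      (s * fderiv ℝ (fderiv ℝ G) (0, 0, s * y) (0, 0, 1) v) y := by
  have h := (hasFDerivAt_fderiv_apply hG v).comp_hasDerivAt y (hasDerivAt_axis_curve s y)
  rwa [map_smul, smul_eq_mul] at h

theorem hasDerivAt_fderiv_rho {y : ℝ} (hG : ContDiffAt ℝ 2 G (0, 0, y)) (v : ℝ × ℝ × ℝ) :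
    HasDerivAt (fun ρ => fderiv ℝ G (0, ρ, y) v)
      (fderiv ℝ (fderiv ℝ G) (0, 0, y) (0, 1, 0) v) 0 := by
  have h := (hasFDerivAt_fderiv_apply hG v).comp_hasDerivAt (0 : ℝ) (hasDerivAt_rho_line y)
  exact h

theorem eventually_abs_sub_lt {y b e : ℝ} (hy : |y - b| < e) : ∀ᶠ t in 𝓝 y, |t - b| < e :=
  (by fun_prop : Continuous fun t => |t - b|).continuousAt.eventually_lt continuousAt_const hy

theorem axisRate_mul_sign {s : ℝ} (hs : s * s = 1) (B y : ℝ) :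
    axisRate B (s * y) = axisRate B y := by
  simp only [axisRate, mul_pow, pow_two s, hs, one_mul]

/-- The solution of `(β² - y²) f' = -2 y f`, `f(β) = 0`, `f'(β) = -1`. -/
theorem eq_of_linear_equation {b e : ℝ} (hb : 0 < b) {f f' : ℝ → ℝ}
    (hpos : ∀ y, |y - b| < e → 0 < y) (he : 0 < e)
    (hf : ∀ y, |y - b| < e → HasDerivAt f (f' y) y) (hfb : f b = 0) (hfb' : f' b = -1)
    (hode : ∀ y, |y - b| < e → (b ^ 2 - y ^ 2) * f' y = -2 * y * f y) {y : ℝ}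
    (hy : |y - b| < e) : f y = (b ^ 2 - y ^ 2) / (2 * b) := by
  have hbb : |b - b| < e := by simpa using he
  have hseg : ∀ t ∈ uIcc y b, |t - b| < e := fun t ht => by
    refine lt_of_le_of_lt ?_ hy
    rw [abs_sub_comm t]
    exact abs_sub_right_of_mem_uIcc ht |>.trans_eq (abs_sub_comm _ _)
  -- The quotient `f / (b² - y²)`, written so that it is continuous at `b`.
  set q : ℝ → ℝ := fun t => dslope f b t / (b + t) with hq
  have hne : ∀ t, |t - b| < e → b + t ≠ 0 := fun t ht => (add_pos hb (hpos t ht)).ne'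
  have hqeq : ∀ t, t ≠ b → q t = f t / (t - b) / (b + t) := fun t ht => by
    rw [hq]
    simp only [dslope_of_ne _ ht, slope_def_field, hfb, sub_zero]
  have hcont : ContinuousOn q (uIcc y b) := fun t ht => by
    refine ContinuousAt.continuousWithinAt (ContinuousAt.div ?_ (by fun_prop) (hne t (hseg t ht)))
    rcases eq_or_ne t b with rfl | hn
    · exact continuousAt_dslope_same.2 (hf _ hbb).differentiableAt
    · exact (continuousAt_dslope_of_ne hn).2 (hf t (hseg t ht)).continuousAt
  have hderiv : ∀ t ∈ Ioo (min y b) (max y b) \ ({b} : Set ℝ), HasDerivAt q 0 t := by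
    rintro t ⟨ht, htb⟩
    have htI : |t - b| < e := hseg t (Ioo_subset_Icc_self ht)
    have h1 : t - b ≠ 0 := sub_ne_zero.2 htb
    have h2 := hne t htI
    refine ((((hf t htI).fun_div ((hasDerivAt_id' t).sub_const b) h1).fun_div
      ((hasDerivAt_id' t).const_add b) h2).congr_of_eventuallyEq ?_).congr_deriv ?_
    · filter_upwards [isOpen_ne.mem_nhds htb] with r hr using hqeq r hr
    · have h3 := hode t htI
      field_simp
      linear_combination -h3
  have h0 := MeasureTheory.integral_eq_of_hasDerivAt_off_countable q (fun _ => 0)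
    (countable_singleton b) hcont hderiv (by simp)
  have hqb : q b = -1 / (2 * b) := by
    simp only [hq, dslope_same, (hf b hbb).deriv, hfb', two_mul]
  have h1 : q y = -1 / (2 * b) := by
    rw [← hqb]
    simpa [sub_eq_zero, eq_comm] using h0
  rcases eq_or_ne y b with rfl | hn
  · simp [hfb]
  · rw [hqeq y hn] at h1
    have h2 : y - b ≠ 0 := sub_ne_zero.2 hn
    have h3 := hne y hy
    field_simp at h1 ⊢
    linear_combination h1

/-- The values and the `x̄`-derivatives of a chart on the axis, as functions of `y = s x̄`, and the
first-order part in `ρ` of the normal form: a singular linear equation for the `ρ`-derivative. -/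
theorem IsNormalizingChart.axis_equations (h : IsNormalizingChart u B₀ A s k e G) (hk : 2 ≤ k)
    (hs : s * s = 1) (hB : 1 / 2 < A.B) :
    (∀ y, |y - beta A.B| < e → G (0, 0, s * y) = (beta A.B ^ 2 - y ^ 2) / (2 * beta A.B) ∧
      fderiv ℝ G (0, 0, s * y) (0, 0, 1) = -s * y / beta A.B) ∧
    ∃ (k' : ℝ → ℝ) (η : ℝ), (ratio B₀ ≠ 1 → η = 0) ∧ ∀ y, |y - beta A.B| < e →
      HasDerivAt (fun y => s * fderiv ℝ G (0, 0, s * y) (0, 1, 0)) (k' y) y ∧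
      axisRate A.B y * k' y + (ratio A.B - 1) * y * (s * fderiv ℝ G (0, 0, s * y) (0, 1, 0)) =
        A.mu3 / beta A.B * (axisRate A.B y - y ^ 2) + y * η := by
  have hβ := beta_pos hB
  have hσ := ratio_pos hB
  have hs0 : s ≠ 0 := left_ne_zero_of_mul_eq_one hs
  obtain ⟨φ₀, ζ, η₁, hζ0, hζ, hη₁, hplane⟩ := h.plane_equation hs
  have hCD : ∀ y, |y - beta A.B| < e → ContDiffAt ℝ 2 G (0, 0, s * y) := fun y hy =>
    h.contDiffAt hk ((mem_chart_ball_axis hs h.pos).2 hy)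
  have hGβ : G (0, 0, s * beta A.B) = 0 := h.map_center
  have hGxβ : fderiv ℝ G (0, 0, s * beta A.B) (0, 0, 1) = -s := h.deriv_x
  have hββ : |beta A.B - beta A.B| < e := by simpa using h.pos
  have haxis : ∀ y, |y - beta A.B| < e →
      axisRate A.B y * fderiv ℝ G (0, 0, s * y) (0, 0, 1) =
        s * y * (-(ratio A.B + φ₀) * G (0, 0, s * y)) := fun y hy => by
    have h1 := (hplane y hy).self_of_nhds
    rw [xRate_axis hB u rfl, hζ0, axisRate_mul_sign hs] at h1
    linear_combination h1
  -- Comparing derivatives at the singular point gives the eigenvalue ratio.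
  have hφ0 : φ₀ = 0 := by
    have h1 := (hasDerivAt_axisRate A.B (beta A.B)).fun_mul
      (hasDerivAt_fderiv_axis (hCD _ hββ) (0, 0, 1))
    have h2 : HasDerivAt (fun y => s * y * (-(ratio A.B + φ₀) * G (0, 0, s * y))) _ (beta A.B) :=
      ((hasDerivAt_id' (beta A.B)).const_mul s).fun_mul
        ((hasDerivAt_comp_axis (hCD _ hββ)).const_mul (-(ratio A.B + φ₀)))
    have h3 := h1.unique (h2.congr_of_eventuallyEq ((eventually_abs_sub_lt hββ).mono haxis))
    have h4 : axisRate A.B (beta A.B) = 0 := by simp [axisRate]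
    rw [hGβ, hGxβ, h4] at h3
    have h5 : s * beta A.B * φ₀ = 0 := by
      linear_combination -h3 - s * beta A.B * (ratio A.B + φ₀) * (hs)
    simpa [hs0, hβ.ne'] using h5
  have hGval : ∀ y, |y - beta A.B| < e →
      G (0, 0, s * y) = (beta A.B ^ 2 - y ^ 2) / (2 * beta A.B) := fun y hy => by
    refine eq_of_linear_equation hβ (f := fun y => G (0, 0, s * y))
      (fun y hy => h.pos_of_mem hs hB hy) h.pos
      (fun y hy => hasDerivAt_comp_axis (hCD y hy)) hGβ (by rw [hGxβ]; linear_combination -hs)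
      (fun y hy => ?_) hy
    have h1 := haxis y hy
    rw [hφ0] at h1
    have hτ : 2 * A.B - 1 ≠ 0 := by linarith
    simp only [axisRate, ratio] at h1
    refine mul_left_cancel₀ hτ ?_
    linear_combination s * h1 - 2 * (2 * A.B - 1) * y * G (0, 0, s * y) * hs
  have hGx : ∀ y, |y - beta A.B| < e →
      fderiv ℝ G (0, 0, s * y) (0, 0, 1) = -s * y / beta A.B := by
    intro y hy
    have h1 := (hasDerivAt_comp_axis (hCD y hy)).unique
      ((((hasDerivAt_pow 2 y).const_sub (beta A.B ^ 2)).div_const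
        (2 * beta A.B)).congr_of_eventuallyEq ((eventually_abs_sub_lt hy).mono hGval))
    have h2 : fderiv ℝ G (0, 0, s * y) (0, 0, 1) =
        s * (s * fderiv ℝ G (0, 0, s * y) (0, 0, 1)) := by
      linear_combination -(fderiv ℝ G (0, 0, s * y) (0, 0, 1)) * hs
    rw [h2, h1]
    field_simp
    norm_num
  refine ⟨fun y hy => ⟨hGval y hy, hGx y hy⟩,
    fun y => fderiv ℝ (fderiv ℝ G) (0, 0, s * y) (0, 0, 1) (0, 1, 0), s * η₁,
    fun hne => by rw [hη₁ hne, mul_zero], fun y hy => ⟨?_, ?_⟩⟩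
  · refine ((hasDerivAt_fderiv_axis (hCD y hy) (0, 1, 0)).const_mul s).congr_deriv ?_
    linear_combination (fderiv ℝ (fderiv ℝ G) (0, 0, s * y) (0, 0, 1) (0, 1, 0)) * hs
  · -- Differentiate the equation on the plane in `ρ` at `ρ = 0`.
    have hGρ : HasDerivAt (fun ρ => G (0, ρ, s * y)) (fderiv ℝ G (0, 0, s * y) (0, 1, 0)) 0 :=
      ((hCD y hy).differentiableAt (by simp)).hasFDerivAt.comp_hasDerivAt (0 : ℝ)
        (hasDerivAt_rho_line (s * y))
    have hg := ((hasDerivAt_id' (0 : ℝ)).const_mul A.mu3).const_sub (s * y)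
    have hQ : HasDerivAt (fun ρ => xRate u A (0, ρ, s * y)) (-(A.mu3 * (s * y))) 0 := by
      have := ((((hasDerivAt_pow 2 (0 : ℝ)).const_mul (2 * A.mu2)).const_sub
        (2 + (1 - 2 * A.B) * (s * y) ^ 2)).fun_sub
          ((hasDerivAt_id' (0 : ℝ)).const_mul (A.mu3 * (s * y))))
      simp only [xRate_plane]
      exact this.congr_deriv (by simp)
    have hL := (((hasDerivAt_id' (0 : ℝ)).fun_neg.fun_mul hg).fun_mul
      (hasDerivAt_fderiv_rho (hCD y hy) (0, 1, 0))).fun_add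
      (hQ.fun_mul (hasDerivAt_fderiv_rho (hCD y hy) (0, 0, 1)))
    have hR := hg.fun_mul ((hGρ.const_mul (-(ratio A.B + φ₀))).fun_add hζ)
    have h3 := hL.unique (hR.congr_of_eventuallyEq (hplane y hy))
    have hsymm := ((hCD y hy).isSymmSndFDerivAt (by simp)) (0, 1, 0) (0, 0, 1)
    rw [hGx y hy, hGval y hy, hζ0, hφ0, hsymm, xRate_axis hB u rfl, axisRate_mul_sign hs] at h3
    simp only [neg_zero, zero_mul, mul_zero, sub_zero, add_zero, mul_one] at h3
    have h4 : A.mu3 / beta A.B * (axisRate A.B y - y ^ 2) =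
        A.mu3 * (ratio A.B * ((beta A.B ^ 2 - y ^ 2) / (2 * beta A.B)) - y * y / beta A.B) := by
      simp only [axisRate, ratio]
      field_simp
    rw [h4]
    have h5 : s * s * (A.mu3 * (y * y / beta A.B)) = A.mu3 * (y * y / beta A.B) := by
      rw [hs, one_mul]
    linear_combination h3 - h5

end Chart

open Classical in
/-- Where the sections at height `X₀` meet the axis, they have the slope
`dx̄/dρ = μ̄₃ · sectionTilt · axisRate / axisPt`. In the resonant case `σ₀ = 1`, where charts are
normalized differently, the formula is a different one. -/
def sectionTilt (B₀ B X₀ : ℝ) : ℝ :=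
  if ratio B₀ = 1 then
    (∫ y in axisPt B X₀..beta B,
        weight B X₀ y * ((y ^ 2)⁻¹ + 2 / ratio B * ((beta B + y) ^ 2)⁻¹)) -
      ((axisPt B X₀)⁻¹ + 2 / ratio B * (beta B + axisPt B X₀)⁻¹)
  else
    ratio B / (ratio B - 1) *
        ((∫ y in axisPt B X₀..beta B, weight B X₀ y * (y ^ 2)⁻¹) - (axisPt B X₀)⁻¹) -
      axisPt B X₀ / ((ratio B - 1) * axisRate B (axisPt B X₀))

section Chart

variable {u : Unfolding} {B₀ : ℝ} {A : Params} {s : ℝ} {k : ℕ} {e : ℝ} {G : ℝ × ℝ × ℝ → ℝ} {X₀ : ℝ}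

/-- The section at height `X₀` meets the axis at `x̄ = s axisPt`. -/
theorem IsNormalizingChart.eq_of_mem_chartSection (h : IsNormalizingChart u B₀ A s k e G)
    (hk : 2 ≤ k) (hs : s * s = 1) (hB : 1 / 2 < A.B) {x : ℝ}
    (hx : (0, 0, x) ∈ chartSection A.B s e G X₀) :
    x = s * axisPt A.B X₀ ∧ |axisPt A.B X₀ - beta A.B| < e := by
  have hβ := beta_pos hB
  have hxs : x = s * (s * x) := by rw [← mul_assoc, hs, one_mul]
  obtain ⟨hball, hGx⟩ := hx
  rw [hxs] at hball hGx
  rw [mem_chart_ball_axis hs h.pos] at hball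
  have hpos := h.pos_of_mem hs hB hball
  rw [((h.axis_equations hk hs hB).1 _ hball).1] at hGx
  have ha : axisPt A.B X₀ = s * x := by
    rw [axisPt, Real.sqrt_eq_iff_mul_self_eq_of_pos hpos]
    field_simp at hGx
    linear_combination -hGx
  exact ⟨by rw [ha, ← hxs], by rwa [ha]⟩

/-- The `ρ`-derivative of a chart where the section meets the axis. -/
theorem IsNormalizingChart.fderiv_rho (h : IsNormalizingChart u B₀ A s k e G)
    (hk : 2 ≤ k) (hs : s * s = 1) (hB : 1 / 2 < A.B) (hX : 0 < X₀) (hX' : 2 * X₀ < beta A.B)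
    (hσ : ratio B₀ ≠ 1 → ratio A.B ≠ 1) (ha : |axisPt A.B X₀ - beta A.B| < e) :
    beta A.B * (s * fderiv ℝ G (0, 0, s * axisPt A.B X₀) (0, 1, 0)) =
      axisRate A.B (axisPt A.B X₀) * (A.mu3 * sectionTilt B₀ A.B X₀) := by
  have hβ := beta_pos hB
  have ha0 := axisPt_pos hX' hβ
  have hab := axisPt_lt hX hβ
  have hσ0 := ratio_pos hB
  have hDa : 0 < axisRate A.B (axisPt A.B X₀) := by
    rw [axisRate_axisPt hX' hβ]
    positivity
  obtain ⟨-, k', η, hη, hode⟩ := h.axis_equations hk hs hB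
  set κ : ℝ → ℝ := fun y => s * fderiv ℝ G (0, 0, s * y) (0, 1, 0) with hκ
  have hI : ∀ y ∈ Icc (axisPt A.B X₀) (beta A.B), |y - beta A.B| < e := fun y hy => by
    rw [abs_of_nonpos (sub_nonpos.2 hy.2)]
    rw [abs_of_neg (sub_neg.2 hab)] at ha
    linarith [hy.1]
  have hβI : beta A.B ∈ Icc (axisPt A.B X₀) (beta A.B) := right_mem_Icc.2 hab.le
  have hDβ : axisRate A.B (beta A.B) = 0 := by simp [axisRate]
  have hpos : ∀ y ∈ Icc (axisPt A.B X₀) (beta A.B), 0 < y := fun y hy => ha0.trans_le hy.1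
  have hode' : ∀ y ∈ Icc (axisPt A.B X₀) (beta A.B),
      axisRate A.B y * (beta A.B * k' y) + (ratio A.B - 1) * y * (beta A.B * κ y) =
        A.mu3 * (axisRate A.B y - y ^ 2) + beta A.B * y * η := fun y hy => by
    have h1 := (hode y (hI y hy)).2
    have h2 : A.mu3 * (axisRate A.B y - y ^ 2) =
        beta A.B * (A.mu3 / beta A.B * (axisRate A.B y - y ^ 2)) := by field_simp
    rw [h2]
    linear_combination beta A.B * h1
  by_cases hres : ratio B₀ = 1
  · have hκβ : κ (beta A.B) = 0 := by
      have : fderiv ℝ G (0, 0, s * beta A.B) (0, 1, 0) = 0 := h.deriv_rho hres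
      rw [hκ]
      simp [this]
    have hημ : η = A.mu3 := by
      have h1 := hode' _ hβI
      rw [hDβ, hκβ] at h1
      have h2 : beta A.B ^ 2 * (η - A.mu3) = 0 := by linear_combination -h1
      rcases mul_eq_zero.1 h2 with h3 | h3
      · exact absurd h3 (by positivity)
      · linarith
    have hZ := singular_linear_solution hB hX hX' (Z := fun y => beta A.B * κ y)
      (Z' := fun y => beta A.B * k' y)
      (m := fun y => A.mu3 * (y⁻¹ + 2 / ratio A.B * (beta A.B + y)⁻¹))
      (m' := fun y => -A.mu3 * ((y ^ 2)⁻¹ + 2 / ratio A.B * ((beta A.B + y) ^ 2)⁻¹))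
      (fun y hy => ((hode y (hI y hy)).1.const_mul _)) (by simp [hκβ])
      (fun y hy => by
        have h1 := hpos y hy
        have h2 := (((hasDerivAt_inv h1.ne').fun_add ((((hasDerivAt_id' y).const_add
          (beta A.B)).fun_inv (add_pos hβ h1).ne').const_mul (2 / ratio A.B))).const_mul A.mu3)
        refine h2.congr_deriv ?_
        ring)
      (by
        refine continuousOn_const.mul (ContinuousOn.add (ContinuousOn.inv₀ (by fun_prop) ?_)
          (continuousOn_const.mul (ContinuousOn.inv₀ (by fun_prop) ?_)))
        · exact fun y hy => (pow_pos (hpos y hy) 2).ne'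
        · exact fun y hy => (pow_pos (add_pos hβ (hpos y hy)) 2).ne')
      (fun y hy => by
        have h1 := hpos y hy
        have h2 := (add_pos hβ h1).ne'
        have h3 := hode' y hy
        have h4 : axisRate A.B y * (2 / ratio A.B * (beta A.B + y)⁻¹) = beta A.B - y := by
          have : ratio A.B = 2 * (2 * A.B - 1) := rfl
          have h5 : (2 * A.B - 1) ≠ 0 := by linarith
          rw [axisRate, this]
          field_simp
          ring
        have h6 : y * y⁻¹ = 1 := mul_inv_cancel₀ h1.ne'
        rw [hημ] at h3
        linear_combination h3 - A.mu3 * y * h4 - A.mu3 * axisRate A.B y * h6)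
    rw [div_eq_iff hDa.ne'] at hZ
    rw [sectionTilt, if_pos hres]
    simp only [mul_left_comm _ (-A.mu3), intervalIntegral.integral_const_mul] at hZ
    linear_combination hZ
  · have hη0 := hη hres
    have hσ1 : ratio A.B - 1 ≠ 0 := sub_ne_zero.2 (hσ hres)
    have hκβ : beta A.B * κ (beta A.B) + A.mu3 / (ratio A.B - 1) * beta A.B = 0 := by
      have h1 := hode' _ hβI
      rw [hDβ, hη0] at h1
      field_simp
      refine mul_left_cancel₀ hβ.ne' ?_
      linear_combination h1
    have hZ := singular_linear_solution hB hX hX'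
      (Z := fun y => beta A.B * κ y + A.mu3 / (ratio A.B - 1) * y)
      (Z' := fun y => beta A.B * k' y + A.mu3 / (ratio A.B - 1))
      (m := fun y => A.mu3 * (ratio A.B / (ratio A.B - 1)) * y⁻¹)
      (m' := fun y => -(A.mu3 * (ratio A.B / (ratio A.B - 1))) * (y ^ 2)⁻¹)
      (fun y hy => (((hode y (hI y hy)).1.const_mul _).fun_add
        ((hasDerivAt_id' y).const_mul _)).congr_deriv (by ring)) hκβ
      (fun y hy => ((hasDerivAt_inv (hpos y hy).ne').const_mul _).congr_deriv (by ring))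
      (continuousOn_const.mul (ContinuousOn.inv₀ (by fun_prop)
        fun y hy => (pow_pos (hpos y hy) 2).ne'))
      (fun y hy => by
        have h1 := hpos y hy
        have h3 := hode' y hy
        rw [hη0] at h3
        field_simp
        linear_combination (ratio A.B - 1) * h3)
    rw [div_eq_iff hDa.ne'] at hZ
    rw [sectionTilt, if_neg hres]
    simp only [mul_left_comm _ (-(A.mu3 * (ratio A.B / (ratio A.B - 1)))),
      intervalIntegral.integral_const_mul] at hZ
    have h5 : axisRate A.B (axisPt A.B X₀) *
        (axisPt A.B X₀ / ((ratio A.B - 1) * axisRate A.B (axisPt A.B X₀))) =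
        axisPt A.B X₀ / (ratio A.B - 1) := by field_simp
    linear_combination hZ + A.mu3 * h5

end Chart

/-! ### Solution curves as a smooth family in a Banach space -/

/-- The identity as an element of `CurveSpace`. -/
def curveParam : CurveSpace := ⟨fun t => t, continuous_subtype_val⟩

/-- The point `(r eʰ, ρ e⁻ʰ, x)`, where `z = (r, ρ)`. Trajectories are sought in this form. -/
def scaledPt (z : ℝ × ℝ) (h x : ℝ) : ℝ × ℝ × ℝ := (z.1 * Real.exp h, z.2 * Real.exp (-h), x)

/-- The curve `t ↦ (r e^{h(t)}, ρ e^{-h(t)}, x₄ + t (x₃ - x₄))` for `v = ((r, ρ), (h, x₃, x₄))`. -/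
def scaledCurve (v : (ℝ × ℝ) × (CurveSpace × ℝ × ℝ)) : CurveSpace × CurveSpace × CurveSpace :=
  (v.1.1 • NormedSpace.exp v.2.1, v.1.2 • NormedSpace.exp (-v.2.1),
    v.2.2.2 • (1 : CurveSpace) + (v.2.2.1 - v.2.2.2) • curveParam)

theorem scaledCurve_apply (z : ℝ × ℝ) (h : CurveSpace) (x₃ x₄ : ℝ) (t : Icc (0 : ℝ) 1) :
    ((scaledCurve (z, h, x₃, x₄)).1 t, (scaledCurve (z, h, x₃, x₄)).2.1 t,
      (scaledCurve (z, h, x₃, x₄)).2.2 t) = scaledPt z (h t) (x₄ + t * (x₃ - x₄)) := by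
  simp [scaledCurve, scaledPt, curveSpace_exp_apply, curveParam, mul_comm]

theorem contDiff_scaledCurve : ContDiff ℝ 2 scaledCurve := by
  have h1 : ContDiff ℝ 2 fun v : (ℝ × ℝ) × (CurveSpace × ℝ × ℝ) => NormedSpace.exp v.2.1 :=
    contDiff_curveSpace_exp.comp (by fun_prop)
  have h2 : ContDiff ℝ 2 fun v : (ℝ × ℝ) × (CurveSpace × ℝ × ℝ) => NormedSpace.exp (-v.2.1) :=
    contDiff_curveSpace_exp.comp (by fun_prop)
  unfold scaledCurve
  fun_prop

theorem eventually_forall_apply_pos {f : CurveSpace} (hf : ∀ t, 0 < f t) :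
    ∀ᶠ g in 𝓝 f, ∀ t, 0 < g t := by
  have h := (ContinuousMap.isOpen_setOfPred_mapsTo (X := Icc (0 : ℝ) 1) (Y := ℝ) isCompact_univ
    (isOpen_Ioi (a := 0))).mem_nhds (x := f) fun t _ => hf t
  filter_upwards [h] with g hg t using hg (mem_univ t)

/-- The partial derivative of the system in the unknowns is triangular. -/
theorem isInvertible_triangular {E : Type*} [NormedAddCommGroup E] [NormedSpace ℝ E]
    (K : ℝ × ℝ →L[ℝ] E) {α γ : ℝ} (hα : α ≠ 0) (hγ : γ ≠ 0) {L : E × ℝ × ℝ →L[ℝ] E × ℝ × ℝ}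
    (hL : ∀ h x y, L (h, x, y) = (h - K (x, y), α * x, γ * y)) : L.IsInvertible := by
  let M : E × ℝ × ℝ →L[ℝ] ℝ × ℝ :=
    (α⁻¹ • (ContinuousLinearMap.fst ℝ ℝ ℝ).comp (ContinuousLinearMap.snd ℝ E (ℝ × ℝ))).prod
      (γ⁻¹ • (ContinuousLinearMap.snd ℝ ℝ ℝ).comp (ContinuousLinearMap.snd ℝ E (ℝ × ℝ)))
  refine ContinuousLinearMap.IsInvertible.of_inverse
    (g := (ContinuousLinearMap.fst ℝ E (ℝ × ℝ) + K.comp M).prod M) ?_ ?_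
  · refine ContinuousLinearMap.ext fun ⟨h, x, y⟩ => ?_
    simp [M, hL, hα, hγ]
  · refine ContinuousLinearMap.ext fun ⟨h, x, y⟩ => ?_
    simp [M, hL, hα, hγ]

/-- The trajectories near the axis from one section to the other form a family of class `C²` with
respect to the point `z = (r, ρ)` of the target section. A trajectory is described by its endpoints
`x₄`, `x₃` and by `h` with `r' / r = h'`, which solves the integral equation `h = ∫₁ᵗ q`. As the
equation for `h` does not involve `h` when `r = ρ = 0`, the implicit function theorem in the Banach
space of continuous functions applies without solving a linearized equation. -/
theorem exists_smooth_trajectories (u : Unfolding) (A : Params) (hB : 1 / 2 < A.B) {a X₃ X₄ : ℝ}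
    (ha : 0 < a) (haβ : a < beta A.B) {G₃ G₄ : ℝ × ℝ × ℝ → ℝ}
    (h₃ : ContDiffAt ℝ 2 G₃ (0, 0, a)) (h₄ : ContDiffAt ℝ 2 G₄ (0, 0, -a))
    (h₃' : fderiv ℝ G₃ (0, 0, a) (0, 0, 1) ≠ 0) (h₄' : fderiv ℝ G₄ (0, 0, -a) (0, 0, 1) ≠ 0)
    (hX₃ : G₃ (0, 0, a) = X₃) (hX₄ : G₄ (0, 0, -a) = X₄) :
    ∃ (h q : ℝ × ℝ → CurveSpace) (x₃ x₄ : ℝ × ℝ → ℝ),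
      ContDiffAt ℝ 2 h 0 ∧ ContDiffAt ℝ 2 q 0 ∧ ContDiffAt ℝ 2 x₃ 0 ∧ ContDiffAt ℝ 2 x₄ 0 ∧
      x₃ 0 = a ∧ x₄ 0 = -a ∧ ∀ᶠ z in 𝓝 0, h z = volterra (q z) ∧ x₄ z < x₃ z ∧
        (∀ t : Icc (0 : ℝ) 1,
          0 < xRate u A (scaledPt z (h z t) (x₄ z + t * (x₃ z - x₄ z))) ∧
          q z t = (x₃ z - x₄ z) * (rate u A (scaledPt z (h z t) (x₄ z + t * (x₃ z - x₄ z))) /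
            xRate u A (scaledPt z (h z t) (x₄ z + t * (x₃ z - x₄ z))))) ∧
        G₃ (z.1, z.2, x₃ z) = X₃ ∧ G₄ (scaledPt z (h z ⟨0, by simp⟩) (x₄ z)) = X₄ := by
  obtain ⟨gL, hgL, hg⟩ := smoothLift_rate u A
  obtain ⟨QL, hQL, hQ⟩ := smoothLift_xRate u A
  set t₀ : Icc (0 : ℝ) 1 := ⟨0, by simp⟩
  set q : (ℝ × ℝ) × (CurveSpace × ℝ × ℝ) → CurveSpace := fun v =>
    (v.2.2.1 - v.2.2.2) • (gL (scaledCurve v) * Ring.inverse (QL (scaledCurve v))) with hq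
  set h₀ : CurveSpace := volterra (q (0, 0, a, -a)) with hh₀
  set v₀ : (ℝ × ℝ) × (CurveSpace × ℝ × ℝ) := (0, h₀, a, -a) with hv₀
  -- On the axis the curves do not depend on `h`.
  have hcurve0 : ∀ h x₃ x₄, scaledCurve (0, h, x₃, x₄) = scaledCurve (0, 0, x₃, x₄) :=
    fun h x₃ x₄ => by simp [scaledCurve]
  have hq0 : ∀ h x₃ x₄, q (0, h, x₃, x₄) = q (0, 0, x₃, x₄) := fun h x₃ x₄ => by
    simp only [hq, hcurve0 h]
  have hQpos : ∀ h t, 0 < QL (scaledCurve (0, h, a, -a)) t := fun h t => by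
    rw [hQ, scaledCurve_apply]
    have h1 : scaledPt 0 (h t) (-a + t * (a - -a)) = (0, 0, -a + t * (a - -a)) := by
      simp [scaledPt]
    rw [h1, xRate_axis hB u rfl]
    refine axisRate_pos hB (lt_of_le_of_lt ?_ haβ)
    rw [abs_le]
    constructor <;> nlinarith [t.2.1, t.2.2]
  have hqC : ∀ h, ContDiffAt ℝ 2 q (0, h, a, -a) := fun h => by
    have h1 : ContDiffAt ℝ 2 (fun v => Ring.inverse (QL (scaledCurve v))) (0, h, a, -a) :=
      ContDiffAt.comp _ (g := Ring.inverse) (f := fun v => QL (scaledCurve v))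
        (contDiffAt_curveSpace_inverse fun t => (hQpos h t).ne')
        (hQL.comp contDiff_scaledCurve).contDiffAt
    have h2 : ContDiff ℝ 2 fun v => gL (scaledCurve v) := hgL.comp contDiff_scaledCurve
    have h3 := h2.contDiffAt.mul h1
    exact (by fun_prop : ContDiffAt ℝ 2 (fun v : (ℝ × ℝ) × (CurveSpace × ℝ × ℝ) =>
      v.2.2.1 - v.2.2.2) _).smul h3
  set start : (ℝ × ℝ) × (CurveSpace × ℝ × ℝ) → ℝ × ℝ × ℝ := fun v =>
    scaledPt v.1 (v.2.1 t₀) v.2.2.2 with hstart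
  have hstartC : ContDiff ℝ 2 start := by
    have h1 : ContDiff ℝ 2 fun v : (ℝ × ℝ) × (CurveSpace × ℝ × ℝ) => v.2.1 t₀ :=
      (ContinuousMap.evalCLM (M := ℝ) ℝ t₀).contDiff.comp (contDiff_fst.comp contDiff_snd)
    simp only [hstart, scaledPt]
    fun_prop
  have hstart0 : ∀ h x₃ x₄, start (0, h, x₃, x₄) = (0, 0, x₄) := fun h x₃ x₄ => by
    simp [hstart, scaledPt]
  set Θ : (ℝ × ℝ) × (CurveSpace × ℝ × ℝ) → CurveSpace × ℝ × ℝ := fun v =>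
    (v.2.1 - volterra (q v), G₃ (v.1.1, v.1.2, v.2.2.1), G₄ (start v)) with hΘ
  have hΘC : ContDiffAt ℝ 2 Θ v₀ := by
    refine ContDiffAt.prodMk ?_ (ContDiffAt.prodMk ?_ ?_)
    · exact (by fun_prop : ContDiffAt ℝ 2 (fun v : (ℝ × ℝ) × (CurveSpace × ℝ × ℝ) => v.2.1) _).sub
        (volterra.contDiff.contDiffAt.comp _ (hqC h₀))
    · exact ContDiffAt.comp v₀ (g := G₃) (f := fun v => (v.1.1, v.1.2, v.2.2.1)) h₃ (by fun_prop)
    · refine ContDiffAt.comp v₀ (g := G₄) (f := start) ?_ hstartC.contDiffAt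
      rw [hv₀, hstart0]
      exact h₄
  have hinv : (fderiv ℝ Θ v₀ ∘L .inr ℝ (ℝ × ℝ) (CurveSpace × ℝ × ℝ)).IsInvertible := by
    have hK : ContDiffAt ℝ 2 (fun y : ℝ × ℝ => volterra (q (0, 0, y.1, y.2))) (a, -a) :=
      volterra.contDiff.contDiffAt.comp _ (ContDiffAt.comp (a, -a) (g := q)
        (f := fun y : ℝ × ℝ => ((0 : ℝ × ℝ), (0 : CurveSpace), y.1, y.2)) (hqC 0) (by fun_prop))
    have hKd := (hK.differentiableAt (by simp)).hasFDerivAt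
    set K := fderiv ℝ (fun y : ℝ × ℝ => volterra (q (0, 0, y.1, y.2))) (a, -a)
    have hΘd := (hΘC.differentiableAt (by simp)).hasFDerivAt
    have hin : HasFDerivAt (fun y : CurveSpace × ℝ × ℝ => ((0 : ℝ × ℝ), y))
        (.inr ℝ (ℝ × ℝ) (CurveSpace × ℝ × ℝ)) (h₀, a, -a) :=
      (hasFDerivAt_const _ _).prodMk (hasFDerivAt_id _)
    have hcomp : HasFDerivAt (fun y : CurveSpace × ℝ × ℝ => Θ (0, y)) _ (h₀, a, -a) :=
      HasFDerivAt.comp (h₀, a, -a) (g := Θ) hΘd hin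
    have hrestrict : (fun y : CurveSpace × ℝ × ℝ => Θ (0, y)) = fun y =>
        (y.1 - volterra (q (0, 0, y.2.1, y.2.2)), G₃ (0, 0, y.2.1), G₄ (0, 0, y.2.2)) := by
      funext ⟨h, x₃, x₄⟩
      simp only [hΘ, hq0 h, hstart0]
      rfl
    have hy3 : HasFDerivAt (fun y : CurveSpace × ℝ × ℝ => ((0 : ℝ), (0 : ℝ), y.2.1))
        ((0 : CurveSpace × ℝ × ℝ →L[ℝ] ℝ).prod ((0 : CurveSpace × ℝ × ℝ →L[ℝ] ℝ).prod
          ((ContinuousLinearMap.fst ℝ ℝ ℝ).comp (.snd ℝ CurveSpace (ℝ × ℝ))))) (h₀, a, -a) :=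
      (hasFDerivAt_const _ _).prodMk ((hasFDerivAt_const _ _).prodMk
        (hasFDerivAt_fst.comp _ hasFDerivAt_snd))
    have hy4 : HasFDerivAt (fun y : CurveSpace × ℝ × ℝ => ((0 : ℝ), (0 : ℝ), y.2.2))
        ((0 : CurveSpace × ℝ × ℝ →L[ℝ] ℝ).prod ((0 : CurveSpace × ℝ × ℝ →L[ℝ] ℝ).prod
          ((ContinuousLinearMap.snd ℝ ℝ ℝ).comp (.snd ℝ CurveSpace (ℝ × ℝ))))) (h₀, a, -a) :=
      (hasFDerivAt_const _ _).prodMk ((hasFDerivAt_const _ _).prodMk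
        (hasFDerivAt_snd.comp _ hasFDerivAt_snd))
    have hd := ((hasFDerivAt_fst (𝕜 := ℝ) (p := (h₀, a, -a))).sub
      (HasFDerivAt.comp (h₀, a, -a) (g := fun y : ℝ × ℝ => volterra (q (0, 0, y.1, y.2)))
        (f := fun y : CurveSpace × ℝ × ℝ => y.2) hKd hasFDerivAt_snd)).prodMk
      ((HasFDerivAt.comp (h₀, a, -a) (g := G₃) (h₃.differentiableAt (by simp)).hasFDerivAt
        hy3).prodMk
      (HasFDerivAt.comp (h₀, a, -a) (g := G₄) (h₄.differentiableAt (by simp)).hasFDerivAt hy4))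
    rw [hrestrict] at hcomp
    rw [hcomp.unique hd]
    have hscale : ∀ (G : ℝ × ℝ × ℝ → ℝ) (z : ℝ × ℝ × ℝ) (x : ℝ),
        fderiv ℝ G z (0, 0, x) = fderiv ℝ G z (0, 0, 1) * x := fun G z x => by
      have : ((0 : ℝ), (0 : ℝ), x) = x • ((0 : ℝ), (0 : ℝ), (1 : ℝ)) := by simp
      rw [this, map_smul, smul_eq_mul, mul_comm]
    refine isInvertible_triangular K h₃' h₄' fun h x y => ?_
    simp [hscale G₃ _ x, hscale G₄ _ y]
  have htwo : (2 : WithTop ℕ∞) ≠ 0 := by simp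
  set ψ := hΘC.implicitFunction htwo hinv
  have hψC : ContDiffAt ℝ 2 ψ 0 := hΘC.contDiffAt_implicitFunction htwo hinv
  have hψ0 : ψ 0 = (h₀, a, -a) := hΘC.implicitFunction_apply_self htwo hinv
  have hψ : ∀ᶠ z in 𝓝 (0 : ℝ × ℝ), Θ (z, ψ z) = Θ v₀ :=
    hΘC.eventually_apply_implicitFunction htwo hinv
  have hpair : ContDiffAt ℝ 2 (fun z => (z, ψ z)) (0 : ℝ × ℝ) := contDiffAt_id.prodMk hψC
  have hqψ : ContDiffAt ℝ 2 (fun z => q (z, ψ z)) (0 : ℝ × ℝ) := by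
    refine ContDiffAt.comp (0 : ℝ × ℝ) (g := q) ?_ hpair
    rw [hψ0]
    exact hqC h₀
  have hΘ0 : Θ v₀ = (0, X₃, X₄) := by
    simp only [hΘ, hv₀, hq0 h₀, hstart0, ← hh₀, sub_self, hX₄]
    simp [hX₃]
  have hposψ : ∀ᶠ z in 𝓝 (0 : ℝ × ℝ), ∀ t, 0 < QL (scaledCurve (z, ψ z)) t := by
    have hc : ContinuousAt (fun z => QL (scaledCurve (z, ψ z))) (0 : ℝ × ℝ) :=
      (hQL.comp contDiff_scaledCurve).continuous.continuousAt.comp (f := fun z => (z, ψ z))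
        hpair.continuousAt
    refine hc.eventually (eventually_forall_apply_pos ?_)
    simp only [hψ0]
    exact hQpos h₀
  have hx₃C : ContDiffAt ℝ 2 (fun z => (ψ z).2.1) 0 := by fun_prop
  have hx₄C : ContDiffAt ℝ 2 (fun z => (ψ z).2.2) 0 := by fun_prop
  have hlt : ∀ᶠ z in 𝓝 (0 : ℝ × ℝ), (ψ z).2.2 < (ψ z).2.1 :=
    hx₄C.continuousAt.eventually_lt hx₃C.continuousAt (by simp only [hψ0]; linarith)
  refine ⟨fun z => (ψ z).1, fun z => q (z, ψ z), fun z => (ψ z).2.1, fun z => (ψ z).2.2,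
    by fun_prop, hqψ, hx₃C, hx₄C, by simp [hψ0], by simp [hψ0], ?_⟩
  filter_upwards [hψ, hposψ, hlt] with z hz hpos hzlt
  rw [hΘ0] at hz
  simp only [hΘ, Prod.mk.injEq] at hz
  refine ⟨sub_eq_zero.1 hz.1, hzlt, fun t => ?_, hz.2.1, hz.2.2⟩
  have e := scaledCurve_apply z (ψ z).1 (ψ z).2.1 (ψ z).2.2 t
  have e1 := hQ (scaledCurve (z, ψ z)) t
  have e2 := hg (scaledCurve (z, ψ z)) t
  rw [e] at e1 e2
  refine ⟨e1 ▸ hpos t, ?_⟩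
  rw [← e1, ← e2]
  simp only [hq, ContinuousMap.smul_apply, ContinuousMap.mul_apply, smul_eq_mul]
  rw [curveSpace_inverse_apply fun t => (hpos t).ne', div_eq_mul_inv]

/-! ### From the integral equation to trajectories -/

/-- A change of time with prescribed positive speed `ds/dt = 1 / l(s)`. -/
theorem exists_time_change {l : ℝ → ℝ} (hl : Continuous l) {m : ℝ} (hm : 0 < m)
    (hml : ∀ s, m ≤ l s) :
    ∃ (σ : ℝ → ℝ) (T : ℝ), 0 ≤ T ∧ σ 0 = 0 ∧ σ T = 1 ∧ (∀ t, HasDerivAt σ (l (σ t))⁻¹ t) ∧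
      ∀ t ∈ Icc 0 T, σ t ∈ Icc (0 : ℝ) 1 := by
  set τ : ℝ → ℝ := fun s => ∫ r in (0 : ℝ)..s, l r with hτ
  have hd : ∀ s, HasDerivAt τ (l s) s := fun s => (hl.integral_hasStrictDerivAt 0 s).hasDerivAt
  have hmono : StrictMono τ := strictMono_of_deriv_pos fun s => by
    rw [(hd s).deriv]
    exact hm.trans_le (hml s)
  have hdiff : Monotone fun s => τ s - m * s :=
    monotone_of_deriv_nonneg
      (fun s => ((hd s).sub ((hasDerivAt_id' s).const_mul m)).differentiableAt)
      fun s => by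
        have h := (hd s).fun_sub ((hasDerivAt_id' s).const_mul m)
        rw [h.deriv, mul_one]
        exact sub_nonneg.2 (hml s)
  have hτ0 : τ 0 = 0 := by simp [hτ]
  have hcont : Continuous τ := continuous_iff_continuousAt.2 fun s => (hd s).continuousAt
  have hsurj : Function.Surjective τ := by
    refine hcont.surjective ?_ ?_
    · refine tendsto_atTop_mono' _ ?_ (tendsto_id.const_mul_atTop hm)
      filter_upwards [eventually_ge_atTop 0] with s hs
      have := hdiff hs
      simp only [hτ0] at this
      simp only [id]
      linarith
    · refine tendsto_atBot_mono' _ ?_ (tendsto_id.const_mul_atBot hm)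
      filter_upwards [eventually_le_atBot 0] with s hs
      have := hdiff hs
      simp only [hτ0] at this
      simp only [id]
      linarith
  set e := hmono.orderIsoOfSurjective τ hsurj
  have he : ∀ s, e s = τ s := fun s => rfl
  have h0 : e.symm 0 = 0 := by rw [OrderIso.symm_apply_eq, he, hτ0]
  have h1 : e.symm (τ 1) = 1 := by rw [OrderIso.symm_apply_eq, he]
  refine ⟨e.symm, τ 1, hτ0 ▸ hmono.monotone zero_le_one, h0, h1, fun t => ?_, fun t ht => ?_⟩
  · exact (hd (e.symm t)).of_local_left_inverse e.symm.continuous.continuousAt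
      (hm.trans_le (hml _)).ne' (Eventually.of_forall fun y => e.apply_symm_apply y)
  · exact ⟨h0 ▸ e.symm.monotone ht.1, h1 ▸ e.symm.monotone ht.2⟩

theorem flowsTo_of_integral_equation (u : Unfolding) (A : Params) (z : ℝ × ℝ) {h q : CurveSpace}
    {x₃ x₄ : ℝ} (hh : h = volterra q) (hx : x₄ < x₃)
    (hq : ∀ t : Icc (0 : ℝ) 1, 0 < xRate u A (scaledPt z (h t) (x₄ + t * (x₃ - x₄))) ∧
      q t = (x₃ - x₄) * (rate u A (scaledPt z (h t) (x₄ + t * (x₃ - x₄))) /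
        xRate u A (scaledPt z (h t) (x₄ + t * (x₃ - x₄))))) :
    FlowsTo (blowUpField u A) (scaledPt z (h ⟨0, by simp⟩) x₄) (z.1, z.2, x₃) := by
  have hx' : 0 < x₃ - x₄ := sub_pos.2 hx
  set c : Icc (0 : ℝ) 1 → ℝ × ℝ × ℝ := fun t => scaledPt z (h t) (x₄ + t * (x₃ - x₄)) with hc
  have hcc : Continuous c := by
    simp only [hc, scaledPt]
    fun_prop
  set l₀ : Icc (0 : ℝ) 1 → ℝ := fun t => (x₃ - x₄) / xRate u A (c t) with hl₀
  have hl₀c : Continuous l₀ :=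
    continuous_const.div ((contDiff_xRate u A (n := 0)).continuous.comp hcc) fun t => (hq t).1.ne'
  obtain ⟨t₁, -, ht₁⟩ := isCompact_univ.exists_isMinOn (univ_nonempty (α := Icc (0 : ℝ) 1))
    hl₀c.continuousOn
  obtain ⟨σ, T, hT, hσ0, hσT, hσ, hσI⟩ := exists_time_change
    (l := IccExtend zero_le_one l₀) (hl₀c.Icc_extend' (h := zero_le_one)) (m := l₀ t₁)
    (div_pos hx' (hq t₁).1) (fun s => ht₁ (mem_univ _))
  set H : ℝ → ℝ := fun s => ∫ r in (1 : ℝ)..s, IccExtend zero_le_one q r with hH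
  have hHd : ∀ s, HasDerivAt H (IccExtend zero_le_one q s) s := fun s =>
    ((q.continuous.Icc_extend' (h := zero_le_one)).integral_hasStrictDerivAt 1 s).hasDerivAt
  have hHh : ∀ t : Icc (0 : ℝ) 1, H t = h t := fun t => by rw [hh, volterra_apply]
  refine ⟨T, fun t => scaledPt z (H (σ t)) (x₄ + σ t * (x₃ - x₄)), hT, ?_, ?_, ?_⟩
  · simp only [hσ0, zero_mul, add_zero]
    rw [← hHh]
  · have : H 1 = 0 := by simp [hH]
    simp [hσT, this, scaledPt]
  · intro t ht
    have hs := hσI t ht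
    have e1 : IccExtend zero_le_one q (σ t) = q ⟨σ t, hs⟩ := IccExtend_of_mem _ _ hs
    have e2 : IccExtend zero_le_one l₀ (σ t) = l₀ ⟨σ t, hs⟩ := IccExtend_of_mem _ _ hs
    set P := scaledPt z (H (σ t)) (x₄ + σ t * (x₃ - x₄)) with hP
    have e3 : c ⟨σ t, hs⟩ = P := by
      rw [hP, show H (σ t) = h ⟨σ t, hs⟩ from hHh ⟨σ t, hs⟩]
    have hpos : 0 < xRate u A P := e3 ▸ (hq ⟨σ t, hs⟩).1
    have hqt : q ⟨σ t, hs⟩ = (x₃ - x₄) * (rate u A P / xRate u A P) := e3 ▸ (hq ⟨σ t, hs⟩).2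
    have hlt : l₀ ⟨σ t, hs⟩ = (x₃ - x₄) / xRate u A P := e3 ▸ rfl
    have hσt := hσ t
    rw [e2, hlt] at hσt
    have hHσ : HasDerivAt (fun t => H (σ t)) _ t := (hHd (σ t)).comp t hσt
    rw [e1, hqt] at hHσ
    have hd := (hHσ.exp.const_mul z.1).prodMk ((hHσ.fun_neg.exp.const_mul z.2).prodMk
      ((hσt.mul_const (x₃ - x₄)).const_add x₄))
    refine HasDerivAt.hasDerivWithinAt (hd.congr_deriv ?_)
    change _ = blowUpField u A P
    rw [blowUpField_eq]
    have e4 : P.1 = z.1 * Real.exp (H (σ t)) := rfl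
    have e5 : P.2.1 = z.2 * Real.exp (-H (σ t)) := rfl
    rw [e4, e5, Prod.mk.injEq, Prod.mk.injEq]
    refine ⟨?_, ?_, ?_⟩ <;> field_simp

/-! ### The first variation along the axis -/

/-- The contribution of the first variation of the vector field to the derivative of the transition,
for `μ̄₃ = 1`. -/
def variationIntegral (B X₀ : ℝ) : ℝ :=
  ∫ x in (-axisPt B X₀)..axisPt B X₀,
    weight B X₀ x * ((x ^ 2 - axisRate B x) / axisRate B x ^ 2)

section Variation

variable {B X₀ : ℝ}

theorem continuous_axisRate (B : ℝ) : Continuous (axisRate B) := by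
  unfold axisRate
  fun_prop

theorem weight_pos (hX : 0 < X₀) (hB : 1 / 2 < B) {x : ℝ} (hx : |x| < beta B) :
    0 < weight B X₀ x := by
  have hβ := beta_pos hB
  have h := sq_lt_sq' (neg_lt_of_abs_lt hx) (lt_of_abs_lt hx)
  exact Real.rpow_pos_of_pos (div_pos (by linarith) (by positivity)) _

theorem abs_affine_le {a t : ℝ} (ha : 0 < a) (ht : t ∈ Icc (0 : ℝ) 1) :
    |-a + t * (a - -a)| ≤ a := by
  rw [abs_le]
  constructor <;> nlinarith [ht.1, ht.2]

theorem integral_affine (a : ℝ) (f : ℝ → ℝ) :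
    ∫ t in (0 : ℝ)..1, 2 * a * f (-a + t * (a - -a)) = ∫ x in -a..a, f x := by
  have h := intervalIntegral.mul_integral_comp_mul_add (a := 0) (b := 1) (f := f) (2 * a) (-a)
  have e : (fun t => f (-a + t * (a - -a))) = fun t => f (2 * a * t + -a) := by
    funext t
    ring_nf
  rw [intervalIntegral.integral_const_mul, e, h]
  congr 1 <;> ring

/-- The unperturbed trajectory along the axis. -/
theorem exp_neg_volterra_eq_weight (hB : 1 / 2 < B) (hX : 0 < X₀) (hX' : 2 * X₀ < beta B)
    {h q : CurveSpace} (hh : h = volterra q)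
    (hq : ∀ t : Icc (0 : ℝ) 1, q t = (axisPt B X₀ - -axisPt B X₀) *
      ((-axisPt B X₀ + t * (axisPt B X₀ - -axisPt B X₀)) /
        axisRate B (-axisPt B X₀ + t * (axisPt B X₀ - -axisPt B X₀)))) (t : Icc (0 : ℝ) 1) :
    Real.exp (-h t) = weight B X₀ (-axisPt B X₀ + t * (axisPt B X₀ - -axisPt B X₀)) := by
  have hβ := beta_pos hB
  have ha := axisPt_pos hX' hβ
  have hab := axisPt_lt hX hβ
  have hw1 := weight_axisPt hX hX' hβ
  set a := axisPt B X₀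
  have habs : ∀ s ∈ Icc (0 : ℝ) 1, |-a + s * (a - -a)| < beta B := fun s hs =>
    (abs_affine_le ha hs).trans_lt hab
  have hd : ∀ s ∈ Icc (0 : ℝ) 1,
      HasDerivAt (fun s => -Real.log (weight B X₀ (-a + s * (a - -a))))
        ((a - -a) * ((-a + s * (a - -a)) / axisRate B (-a + s * (a - -a)))) s := fun s hs => by
    have h1 : HasDerivAt (fun s : ℝ => -a + s * (a - -a)) (a - -a) s := by
      simpa using ((hasDerivAt_id' s).mul_const (a - -a)).const_add (-a)
    have h2 : HasDerivAt (fun s : ℝ => weight B X₀ (-a + s * (a - -a))) _ s :=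
      HasDerivAt.comp s (h₂ := weight B X₀) (hasDerivAt_weight hB hX (habs s hs)) h1
    have hw := weight_pos hX hB (habs s hs)
    refine ((h2.log hw.ne').neg).congr_deriv ?_
    rw [neg_mul, neg_div, neg_neg, mul_right_comm, mul_div_cancel_right₀ _ hw.ne', mul_comm]
  have hsub : uIcc (1 : ℝ) t ⊆ Icc 0 1 := by
    rw [uIcc_of_ge t.2.2]
    exact Icc_subset_Icc_left t.2.1
  have hint := intervalIntegral.integral_eq_sub_of_hasDerivAt (a := 1) (b := (t : ℝ))
    (f := fun s => -Real.log (weight B X₀ (-a + s * (a - -a)))) (f' := IccExtend zero_le_one q)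
    (fun s hs => by
      rw [IccExtend_of_mem _ _ (hsub hs), hq]
      exact hd s (hsub hs))
    ((q.continuous.Icc_extend' (h := zero_le_one)).intervalIntegrable _ _)
  have h1 : -a + 1 * (a - -a) = a := by ring
  rw [h1, hw1, Real.log_one, neg_zero, sub_zero] at hint
  rw [hh, volterra_apply, hint, neg_neg, Real.exp_log (weight_pos hX hB (habs t t.2))]

theorem integral_variation (hB : 1 / 2 < B) (hX : 0 < X₀) (hX' : 2 * X₀ < beta B) (a₁ μ : ℝ) :
    ∫ x in (-axisPt B X₀)..axisPt B X₀,
      (a₁ * ((axisRate B x + ratio B * x ^ 2) / axisRate B x ^ 2) +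
      μ * (weight B X₀ x * ((x ^ 2 - axisRate B x) / axisRate B x ^ 2))) =
    a₁ * (2 * axisPt B X₀ / axisRate B (axisPt B X₀)) + μ * variationIntegral B X₀ := by
  have hβ := beta_pos hB
  have ha := axisPt_pos hX' hβ
  have hab := axisPt_lt hX hβ
  have hsub : ∀ x ∈ uIcc (-axisPt B X₀) (axisPt B X₀), 0 < axisRate B x := fun x hx => by
    rw [uIcc_of_le (by linarith)] at hx
    exact axisRate_pos hB ((abs_le.2 ⟨hx.1, hx.2⟩).trans_lt hab)
  have hD2 : ∀ x ∈ uIcc (-axisPt B X₀) (axisPt B X₀), axisRate B x ^ 2 ≠ 0 := fun x hx =>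
    (pow_pos (hsub x hx) 2).ne'
  have hDc := continuous_axisRate B
  have hi1 : IntervalIntegrable (fun x => (axisRate B x + ratio B * x ^ 2) / axisRate B x ^ 2)
      MeasureTheory.volume (-axisPt B X₀) (axisPt B X₀) :=
    ContinuousOn.intervalIntegrable (ContinuousOn.div (by fun_prop) (by fun_prop) hD2)
  have hi2 : IntervalIntegrable
      (fun x => weight B X₀ x * ((x ^ 2 - axisRate B x) / axisRate B x ^ 2))
      MeasureTheory.volume (-axisPt B X₀) (axisPt B X₀) :=
    ContinuousOn.intervalIntegrable ((continuous_weight hB).continuousOn.mul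
      (ContinuousOn.div (by fun_prop) (by fun_prop) hD2))
  rw [intervalIntegral.integral_add (hi1.const_mul a₁) (hi2.const_mul μ),
    intervalIntegral.integral_const_mul, intervalIntegral.integral_const_mul, variationIntegral]
  congr 2
  rw [intervalIntegral.integral_eq_sub_of_hasDerivAt (f := fun x => x / axisRate B x)
    (fun x hx => ?_) hi1, axisRate_neg]
  · ring
  · refine ((hasDerivAt_id' x).fun_div (hasDerivAt_axisRate B x) (hsub x hx).ne').congr_deriv ?_
    ring

end Variation

/-- The derivative of `log F` along `r = 0`, where the slopes of both sections on the axis agree. -/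
theorem hasDerivAt_log_factor (u : Unfolding) (A : Params) {X₀ a₁ : ℝ} (hB : 1 / 2 < A.B)
    (hX : 0 < X₀) (hX' : 2 * X₀ < beta A.B) {h q : ℝ → CurveSpace} {x₃ x₄ : ℝ → ℝ}
    (hqd : DifferentiableAt ℝ q 0)
    (h₃ : HasDerivAt x₃ a₁ 0) (h₄ : HasDerivAt x₄ a₁ 0) (h₃0 : x₃ 0 = axisPt A.B X₀)
    (h₄0 : x₄ 0 = -axisPt A.B X₀)
    (hw : ∀ t : Icc (0 : ℝ) 1, Real.exp (-h 0 t) =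
      weight A.B X₀ (-axisPt A.B X₀ + t * (axisPt A.B X₀ - -axisPt A.B X₀)))
    (hev : ∀ᶠ ρ in 𝓝 0, h ρ = volterra (q ρ) ∧ ∀ t : Icc (0 : ℝ) 1,
      q ρ t = (x₃ ρ - x₄ ρ) *
        (rate u A (scaledPt (0, ρ) (h ρ t) (x₄ ρ + t * (x₃ ρ - x₄ ρ))) /
          xRate u A (scaledPt (0, ρ) (h ρ t) (x₄ ρ + t * (x₃ ρ - x₄ ρ))))) :
    HasDerivAt (fun ρ => h ρ ⟨0, by simp⟩)
      (-(a₁ * (2 * axisPt A.B X₀ / axisRate A.B (axisPt A.B X₀)) +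
        A.mu3 * variationIntegral A.B X₀)) 0 := by
  have hβ := beta_pos hB
  have ha := axisPt_pos hX' hβ
  have hab := axisPt_lt hX hβ
  set a := axisPt A.B X₀ with ha_def
  set q' := deriv q 0 with hq'
  have hqd' : HasDerivAt q q' 0 := hqd.hasDerivAt
  have hh : HasDerivAt h (volterra q') 0 :=
    (volterra.hasFDerivAt.comp_hasDerivAt (0 : ℝ) hqd').congr_of_eventuallyEq
      (hev.mono fun ρ hρ => hρ.1)
  have heval : ∀ (t : Icc (0 : ℝ) 1) {f : ℝ → CurveSpace} {f' : CurveSpace}, HasDerivAt f f' 0 →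
      HasDerivAt (fun ρ => f ρ t) (f' t) 0 := fun t f f' hf =>
    (ContinuousMap.evalCLM (M := ℝ) ℝ t).hasFDerivAt.comp_hasDerivAt (0 : ℝ) hf
  -- The first variation of the integrand, computed pointwise.
  have hq't : ∀ t : Icc (0 : ℝ) 1, q' t = 2 * a *
      (a₁ * ((axisRate A.B (-a + t * (a - -a)) + ratio A.B * (-a + t * (a - -a)) ^ 2) /
          axisRate A.B (-a + t * (a - -a)) ^ 2) +
        A.mu3 * (weight A.B X₀ (-a + t * (a - -a)) *
          (((-a + t * (a - -a)) ^ 2 - axisRate A.B (-a + t * (a - -a))) /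
            axisRate A.B (-a + t * (a - -a)) ^ 2))) := fun t => by
    have hP : HasDerivAt (fun ρ => ρ * Real.exp (-h ρ t))
        (weight A.B X₀ (-a + t * (a - -a))) 0 :=
      ((hasDerivAt_id' (0 : ℝ)).fun_mul (heval t hh).fun_neg.exp).congr_deriv (by simp [hw])
    have hx : HasDerivAt (fun ρ => x₄ ρ + t * (x₃ ρ - x₄ ρ)) a₁ 0 :=
      (h₄.fun_add ((h₃.fun_sub h₄).const_mul (t : ℝ))).congr_deriv (by simp)
    have hx0 : x₄ 0 + t * (x₃ 0 - x₄ 0) = -a + t * (a - -a) := by rw [h₃0, h₄0]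
    set xt := -a + t * (a - -a)
    have hD : 0 < axisRate A.B xt := axisRate_pos hB ((abs_affine_le ha t.2).trans_lt hab)
    have hQ0 : 2 + (1 - 2 * A.B) * xt ^ 2 = axisRate A.B xt := (axisRate_eq hB xt).symm
    have hg := hx.fun_sub (hP.const_mul A.mu3)
    have hQ := (((((hx.fun_pow 2).const_mul (1 - 2 * A.B)).const_add 2).fun_sub
      ((hP.fun_pow 2).const_mul (2 * A.mu2))).fun_sub ((hx.const_mul A.mu3).fun_mul hP))
    have hfrac := (h₃.fun_sub h₄).fun_mul (hg.fun_div hQ (by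
      simp only [hx0, zero_mul]
      simp [hQ0, hD.ne']))
    have h1 := (heval t hqd').unique (hfrac.congr_of_eventuallyEq (hev.mono fun ρ hρ => by
      refine (hρ.2 t).trans ?_
      simp only [scaledPt, zero_mul, rate_plane, xRate_plane]))
    rw [h1]
    simp only [hx0, zero_mul, sub_self, mul_zero, sub_zero, zero_add]
    simp only [h₃0, h₄0, ne_eq, OfNat.ofNat_ne_zero, not_false_eq_true, zero_pow, mul_zero,
      sub_zero, hQ0]
    have hσ : ratio A.B = 2 * (2 * A.B - 1) := rfl
    rw [hσ]
    field_simp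
    ring
  refine (heval _ hh).congr_deriv ?_
  rw [volterra_apply, intervalIntegral.integral_symm, ← integral_variation hB hX hX' a₁ A.mu3,
    ← integral_affine]
  congr 1
  refine intervalIntegral.integral_congr fun s hs => ?_
  rw [uIcc_of_le zero_le_one] at hs
  rw [IccExtend_of_mem _ _ hs, hq't]

/-! ### Uniqueness of the transition on `r = 0` -/

theorem HasDerivWithinAt.eventually_lt_right {f : ℝ → ℝ} {f' t T : ℝ} (ht : t ∈ Ico 0 T)
    (hf : HasDerivWithinAt f f' (Icc 0 T) t) (hf' : 0 < f') : ∀ᶠ s in 𝓝[>] t, f t < f s := by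
  have h1 : HasDerivWithinAt f f' (Ioi t) t := hf.mono_of_mem_nhdsWithin
    (mem_of_superset (Ioo_mem_nhdsGT ht.2) fun s hs => ⟨ht.1.trans hs.1.le, hs.2.le⟩)
  have h2 := (hasDerivWithinAt_iff_tendsto_slope' self_notMem_Ioi).1 h1
  filter_upwards [h2.eventually (lt_mem_nhds hf'), self_mem_nhdsWithin] with s hs hst
  rw [slope_def_field] at hs
  exact sub_pos.1 ((div_pos_iff_of_pos_right (sub_pos.2 hst)).1 hs)

theorem HasDerivWithinAt.eventually_lt_left {f : ℝ → ℝ} {f' T : ℝ} (hT : 0 < T)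
    (hf : HasDerivWithinAt f f' (Icc 0 T) T) (hf' : 0 < f') : ∀ᶠ s in 𝓝[<] T, f s < f T := by
  have h1 : HasDerivWithinAt f f' (Iio T) T := hf.mono_of_mem_nhdsWithin
    (mem_of_superset (Ioo_mem_nhdsLT hT) fun s hs => ⟨hs.1.le, hs.2.le⟩)
  have h2 := (hasDerivWithinAt_iff_tendsto_slope' self_notMem_Iio).1 h1
  filter_upwards [h2.eventually (lt_mem_nhds hf'), self_mem_nhdsWithin] with s hs hst
  rw [slope_def_field] at hs
  have h3 : s - T < 0 := sub_neg.2 hst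
  by_contra! h4
  exact absurd hs (not_lt.2 (div_nonpos_of_nonneg_of_nonpos (sub_nonneg.2 h4) h3.le))

/-- A trajectory in the plane `r = 0` that starts on a Lipschitz curve `x̄ = x₃(ρ)` across the axis
does not return to it: with `M` a Lipschitz constant, `x̄ + M |ρ|` cannot come back to its initial
value, since `|ρ|` decreases where `x̄` is positive. -/
theorem eq_of_flowsTo_of_graph (u : Unfolding) (A : Params) (hB : 1 / 2 < A.B) {a : ℝ} (ha : 0 < a)
    (haβ : a < beta A.B) {x₃ : ℝ → ℝ} (hx₃ : ContDiffAt ℝ 1 x₃ 0) (h0 : x₃ 0 = a) :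
    ∃ ε > 0, ∀ ρ₁ ρ₂ : ℝ, |ρ₁| < ε → |ρ₂| < ε →
      FlowsTo (blowUpField u A) (0, ρ₁, x₃ ρ₁) (0, ρ₂, x₃ ρ₂) → ρ₁ = ρ₂ := by
  obtain ⟨K, S, hS, hK⟩ := hx₃.exists_lipschitzOnWith
  set M : ℝ := (K : ℝ) with hM
  have hM0 : 0 ≤ M := K.coe_nonneg
  have hQ : ∀ᶠ p : ℝ × ℝ in 𝓝 (0, a),
      0 < xRate u A (0, p.1, p.2) - M * |p.1 * (p.2 - A.mu3 * p.1)| := by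
    have hc : Continuous fun p : ℝ × ℝ =>
        xRate u A (0, p.1, p.2) - M * |p.1 * (p.2 - A.mu3 * p.1)| := by
      have := (contDiff_xRate u A (n := 0)).continuous
      fun_prop
    refine continuousAt_const.eventually_lt hc.continuousAt ?_
    simp only [zero_mul, abs_zero, mul_zero, sub_zero, xRate_axis hB u rfl]
    exact axisRate_pos hB (by rwa [abs_of_pos ha])
  obtain ⟨η, hη, hQ⟩ := Metric.eventually_nhds_iff.1 hQ
  have hx₃c : ∀ᶠ ρ in 𝓝 (0 : ℝ), |x₃ ρ - a| < min (η / 2) (a / 2) := by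
    have := hx₃.continuousAt.sub (continuousAt_const (y := a))
    have h2 := this.abs.eventually_lt (continuousAt_const (y := min (η / 2) (a / 2)))
      (by simp only [Pi.sub_apply, h0, sub_self, abs_zero]; positivity)
    exact h2
  obtain ⟨ε₁, hε₁, h1⟩ := Metric.eventually_nhds_iff.1 (hx₃c.and hS)
  have hden1 : 0 < 2 * (|A.mu3| + 1) := by positivity
  have hden2 : 0 < 2 * (M + 1) := by positivity
  refine ⟨min (min ε₁ η) (min (a / (2 * (|A.mu3| + 1))) (η / (2 * (M + 1)))), by positivity, ?_⟩
  rintro ρ₁ ρ₂ hρ₁ hρ₂ ⟨T, γ, hT, hγ0, hγT, hγ⟩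
  simp only [lt_min_iff] at hρ₁ hρ₂
  obtain ⟨⟨hρ₁1, hρ₁2⟩, hρ₁3, hρ₁4⟩ := hρ₁
  obtain ⟨hx1, hS1⟩ := h1 (y := ρ₁) (by simpa using hρ₁1)
  obtain ⟨-, hS2⟩ := h1 (y := ρ₂) (by simpa using hρ₂.1.1)
  rw [lt_min_iff, abs_lt, abs_lt] at hx1
  rw [lt_div_iff₀ hden1] at hρ₁3
  rw [lt_div_iff₀ hden2] at hρ₁4
  -- The components of the trajectory.
  have hgc : ContinuousOn (fun t => rate u A (γ t)) (Icc 0 T) :=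
    (contDiff_rate u A (n := 0)).continuous.comp_continuousOn hγ.continuousOn
  have hr : ∀ t ∈ Icc 0 T, HasDerivWithinAt (fun t => (γ t).1) ((γ t).1 * rate u A (γ t))
      (Icc 0 T) t := fun t ht => (hγ t ht).fst
  have hρ : ∀ t ∈ Icc 0 T, HasDerivWithinAt (fun t => (γ t).2.1) ((γ t).2.1 * -rate u A (γ t))
      (Icc 0 T) t := fun t ht => by
    have h2 : HasDerivWithinAt (fun t => (γ t).2.1) (-(γ t).2.1 * rate u A (γ t)) (Icc 0 T) t :=
      (hγ t ht).snd.fst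
    exact h2.congr_deriv (by ring)
  have hx : ∀ t ∈ Icc 0 T, HasDerivWithinAt (fun t => (γ t).2.2) (xRate u A (γ t))
      (Icc 0 T) t := fun t ht => (hγ t ht).snd.snd
  obtain ⟨E, -, hE⟩ := exists_pos_eq_mul_of_hasDerivWithinAt hT hgc hr
  obtain ⟨E', hE'0, hE'⟩ := exists_pos_eq_mul_of_hasDerivWithinAt hT hgc.neg hρ
  simp only [hγ0, zero_mul] at hE hE'
  have hTI : T ∈ Icc 0 T := right_mem_Icc.2 hT
  have hρ₂E : ρ₂ = ρ₁ * E' T := by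
    rw [← hE' T hTI, hγT]
  rcases eq_or_ne ρ₁ 0 with rfl | hρne
  · rw [hρ₂E, zero_mul]
  obtain ⟨n, hn, hn1⟩ : ∃ n : ℝ, n * ρ₁ = |ρ₁| ∧ |n| = 1 := by
    rcases abs_choice ρ₁ with h | h
    · exact ⟨1, by rw [one_mul, h], by simp⟩
    · exact ⟨-1, by rw [h]; ring, by simp⟩
  have hρpos : 0 < |ρ₁| := abs_pos.2 hρne
  have hγeq : ∀ t ∈ Icc 0 T, γ t = (0, (γ t).2.1, (γ t).2.2) := fun t ht => by
    rw [← hE t ht]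
  have hnP : ∀ t ∈ Icc 0 T, 0 < n * (γ t).2.1 := fun t ht => by
    rw [hE' t ht, ← mul_assoc, hn]
    exact mul_pos hρpos (hE'0 t)
  have habsP : ∀ t ∈ Icc 0 T, |(γ t).2.1| = n * (γ t).2.1 := fun t ht => by
    rw [← abs_of_pos (hnP t ht), abs_mul, hn1, one_mul]
  set V : ℝ → ℝ := fun t => (γ t).2.2 + M * (n * (γ t).2.1) with hV
  have hV0 : V 0 = x₃ ρ₁ + M * |ρ₁| := by simp only [hV, hγ0, hn]
  have hVd : ∀ t ∈ Icc 0 T, HasDerivWithinAt V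
      (xRate u A (γ t) + M * (n * ((γ t).2.1 * -rate u A (γ t)))) (Icc 0 T) t := fun t ht =>
    (hx t ht).fun_add (((hρ t ht).const_mul n).const_mul M)
  have hPd : ∀ t ∈ Icc 0 T, HasDerivWithinAt (fun t => -(n * (γ t).2.1))
      (n * (γ t).2.1 * rate u A (γ t)) (Icc 0 T) t := fun t ht =>
    ((hρ t ht).const_mul n).fun_neg.congr_deriv (by ring)
  have hVc : ContinuousOn V (Icc 0 T) := fun t ht => (hVd t ht).continuousWithinAt
  have hPc : ContinuousOn (fun t => -(n * (γ t).2.1)) (Icc 0 T) := fun t ht =>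
    (hPd t ht).continuousWithinAt
  set W : Set ℝ := {t | V 0 ≤ V t ∧ -|ρ₁| ≤ -(n * (γ t).2.1)} with hW
  have hgpos : ∀ t ∈ Icc 0 T, t ∈ W → 0 < rate u A (γ t) := fun t ht htW => by
    rw [hγeq t ht, rate_plane]
    have h2 : (γ t).2.2 ≥ x₃ ρ₁ := by
      have := htW.1
      rw [hV0] at this
      have h3 := mul_le_mul_of_nonneg_left (neg_le_neg_iff.1 htW.2) hM0
      simp only [hV] at this
      linarith
    have h4 : A.mu3 * (γ t).2.1 ≤ |A.mu3| * |ρ₁| := by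
      refine (le_abs_self _).trans ?_
      rw [abs_mul, habsP t ht]
      exact mul_le_mul_of_nonneg_left (neg_le_neg_iff.1 htW.2) (abs_nonneg _)
    nlinarith [hx1.2.1]
  have hVpos : ∀ t ∈ Icc 0 T, t ∈ W → V t = V 0 →
      0 < xRate u A (γ t) + M * (n * ((γ t).2.1 * -rate u A (γ t))) := fun t ht htW hVt => by
    have hP1 := neg_le_neg_iff.1 htW.2
    have hP0 := hnP t ht
    have h2 : (γ t).2.2 = x₃ ρ₁ + M * |ρ₁| - M * (n * (γ t).2.1) := by
      rw [hV0] at hVt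
      simp only [hV] at hVt
      linarith
    have h3 := mul_le_mul_of_nonneg_left hP1 hM0
    have h4 := mul_nonneg hM0 hP0.le
    have hdist : dist ((γ t).2.1, (γ t).2.2) ((0 : ℝ), a) < η := by
      rw [Prod.dist_eq, max_lt_iff]
      simp only [Real.dist_eq, sub_zero]
      refine ⟨by rw [habsP t ht]; linarith, ?_⟩
      rw [abs_lt]
      constructor <;> nlinarith [hx1.1.1, hx1.1.2]
    have h5 := hQ hdist
    have h6 : M * (n * ((γ t).2.1 * rate u A (γ t))) ≤
        M * |(γ t).2.1 * ((γ t).2.2 - A.mu3 * (γ t).2.1)| := by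
      refine mul_le_mul_of_nonneg_left ((le_abs_self _).trans ?_) hM0
      rw [abs_mul n, hn1, one_mul]
      conv_lhs => rw [hγeq t ht]
      rw [rate_plane]
    simp only [← hγeq t ht] at h5
    linarith
  have hWall : Icc 0 T ⊆ W := by
    refine IsClosed.Icc_subset_of_forall_exists_gt ?_ ⟨le_rfl, by rw [hγ0, hn]⟩ ?_
    · have h2 := (hVc.prodMk hPc).preimage_isClosed_of_isClosed isClosed_Icc
        (isClosed_Ici (a := (V 0, -|ρ₁|)))
      rwa [inter_comm] at h2
    · rintro t ⟨htW, ht⟩ y hy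
      have htI := Ico_subset_Icc_self ht
      have e1 : ∀ᶠ s in 𝓝[>] t, V 0 ≤ V s := by
        rcases htW.1.eq_or_lt with heq | hlt
        · rw [heq]
          exact (HasDerivWithinAt.eventually_lt_right ht (hVd t htI)
            (hVpos t htI htW heq.symm)).mono fun s hs => hs.le
        · have h3 : ContinuousWithinAt V (Ioi t) t := (hVc t htI).mono_of_mem_nhdsWithin
            (mem_of_superset (Ioo_mem_nhdsGT ht.2) fun s hs => ⟨ht.1.trans hs.1.le, hs.2.le⟩)
          exact (h3.eventually (lt_mem_nhds hlt)).mono fun s hs => hs.le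
      have e2 := HasDerivWithinAt.eventually_lt_right ht (hPd t htI)
        (mul_pos (hnP t htI) (hgpos t htI htW))
      obtain ⟨s, hs1, hs2, hs3⟩ := (e1.and (e2.and (Ioc_mem_nhdsGT hy))).exists
      exact ⟨s, ⟨hs1, htW.2.trans hs2.le⟩, hs3⟩
  have hVT : V T ≤ V 0 := by
    have h2 := hK.dist_le_mul ρ₂ hS2 ρ₁ hS1
    rw [Real.dist_eq, Real.dist_eq] at h2
    have h3 : |ρ₂ - ρ₁| = |ρ₁| - n * ρ₂ := by
      have h4 := neg_le_neg_iff.1 (hWall hTI).2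
      rw [hγT] at h4
      rw [← one_mul |ρ₂ - ρ₁|, ← hn1, ← abs_mul, mul_sub, hn, abs_sub_comm, abs_of_nonneg]
      linarith
    rw [h3] at h2
    rw [hV0]
    simp only [hV, hγT]
    have := (abs_le.1 h2).2
    linarith
  have hVT' : V T = V 0 := le_antisymm hVT (hWall hTI).1
  rcases hT.eq_or_lt with h | h
  · have h2 := hγT
    rw [← h, hγ0] at h2
    simpa using congrArg (fun p : ℝ × ℝ × ℝ => p.2.1) h2
  · obtain ⟨s, hs, hs'⟩ := ((HasDerivWithinAt.eventually_lt_left h (hVd T hTI)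
      (hVpos T hTI (hWall hTI) hVT')).and (Ioo_mem_nhdsLT h)).exists
    exact absurd (hWall ⟨hs'.1.le, hs'.2.le⟩).1 (by rw [hVT'] at hs; exact not_le.2 hs)

/-- On `r = 0` a transition factor is determined near `ρ = 0`. -/
theorem IsTransitionFactor.eventually_eq {X : ℝ × ℝ × ℝ → ℝ × ℝ × ℝ} (hX : ContDiff ℝ 1 X)
    {Sec₃ Sec₄ : Set (ℝ × ℝ × ℝ)}
    (hinj₃ : ∀ ρ x x' : ℝ, (0, ρ, x) ∈ Sec₃ → (0, ρ, x') ∈ Sec₃ → x = x')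
    (hinj₄ : ∀ ρ x x' : ℝ, (0, ρ, x) ∈ Sec₄ → (0, ρ, x') ∈ Sec₄ → x = x')
    {f x₃ : ℝ → ℝ} (hf : ContDiffAt ℝ 1 f 0) (hf0 : f 0 = 1)
    (hcan : ∀ᶠ ρ in 𝓝 (0 : ℝ), (0, ρ, x₃ ρ) ∈ Sec₃ ∧ ∃ x₄, (0, ρ * (f ρ)⁻¹, x₄) ∈ Sec₄ ∧
      FlowsTo X (0, ρ * (f ρ)⁻¹, x₄) (0, ρ, x₃ ρ))
    (hret : ∃ ε > 0, ∀ ρ₁ ρ₂ : ℝ, |ρ₁| < ε → |ρ₂| < ε →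
      FlowsTo X (0, ρ₁, x₃ ρ₁) (0, ρ₂, x₃ ρ₂) → ρ₁ = ρ₂)
    {F : ℝ × ℝ → ℝ} (hF : IsTransitionFactor X Sec₃ Sec₄ F) :
    ∀ᶠ ρ in 𝓝[≠] (0 : ℝ), F (0, ρ) = f ρ := by
  obtain ⟨ε, hε, hret⟩ := hret
  obtain ⟨hFc, hF0, hFt⟩ := hF
  have hτ : ContDiffAt ℝ 1 (fun ρ => ρ * (f ρ)⁻¹) 0 :=
    contDiffAt_id.mul (hf.inv (by simp [hf0]))
  have hτd : HasDerivAt (fun ρ => ρ * (f ρ)⁻¹) 1 0 :=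
    ((hasDerivAt_id' (0 : ℝ)).fun_mul ((hf.differentiableAt (by simp)).hasDerivAt.fun_inv
      (by simp [hf0]))).congr_deriv (by simp [hf0])
  have hτs : HasStrictDerivAt (fun ρ => ρ * (f ρ)⁻¹) 1 0 := hτ.hasStrictDerivAt' hτd (by simp)
  obtain ⟨L, hL, hL0, hLc⟩ : ∃ L : ℝ → ℝ, (∀ᶠ y in 𝓝 (0 : ℝ), L y * (f (L y))⁻¹ = y) ∧
      L 0 = 0 ∧ ContinuousAt L 0 := by
    have hτ' := hτs.hasStrictFDerivAt_equiv one_ne_zero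
    have h00 : (0 : ℝ) * (f 0)⁻¹ = 0 := zero_mul _
    have h1 := hτ'.eventually_right_inverse
    have h2 := hτ'.localInverse_apply_image
    have h3 := hτ'.localInverse_continuousAt
    rw [h00] at h1 h2 h3
    exact ⟨_, h1, h2, h3⟩
  have hline : Tendsto (fun ρ : ℝ => ((0 : ℝ), ρ)) (𝓝 0) (𝓝 (0, 0)) :=
    (by fun_prop : Continuous fun ρ : ℝ => ((0 : ℝ), ρ)).tendsto 0
  have hy : Tendsto (fun ρ => ρ * (F (0, ρ))⁻¹) (𝓝 0) (𝓝 0) := by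
    have h1 := tendsto_id.mul ((hFc.tendsto.comp hline).inv₀ hF0)
    simpa using h1
  have hLt : Tendsto (fun ρ => L (ρ * (F (0, ρ))⁻¹)) (𝓝 0) (𝓝 0) := by
    have h1 := hLc.tendsto
    rw [hL0] at h1
    exact h1.comp hy
  have hsmall : ∀ᶠ ρ in 𝓝 (0 : ℝ), |ρ| < ε :=
    (continuous_abs.tendsto' (0 : ℝ) 0 abs_zero).eventually (gt_mem_nhds hε)
  have hall : ∀ᶠ ρ in 𝓝 (0 : ℝ), ρ ≠ 0 → F (0, ρ) = f ρ := by
    filter_upwards [hline.eventually hFt, hcan, hLt.eventually hcan, hsmall,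
      hLt.eventually hsmall, hy.eventually hL] with ρ hρF hρ hρL hε1 hε2 hLy hne
    obtain ⟨y₃, y₄, hy₃, hy₄, hflow⟩ := hρF
    obtain ⟨hρ3, -⟩ := hρ
    obtain ⟨-, x₄, hx₄, hflow'⟩ := hρL
    simp only [zero_mul] at hy₃ hy₄ hflow
    rw [hLy] at hx₄ hflow'
    obtain rfl := hinj₃ _ _ _ hρ3 hy₃
    obtain rfl := hinj₄ _ _ _ hx₄ hy₄
    have heq : L (ρ * (F (0, ρ))⁻¹) = ρ := by
      rcases hflow.total hX hflow' with h | h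
      · exact (hret _ _ hε1 hε2 h).symm
      · exact hret _ _ hε2 hε1 h
    rw [heq] at hLy
    exact (inv_injective (mul_left_cancel₀ hne hLy)).symm
  exact eventually_nhdsWithin_iff.2 hall

/-! ### The coefficient of `μ̄₃` -/

/-- The coefficient `c(B)` of the second derivative of `S`: twice the derivative of `log F` along
`r = 0`, for `μ̄₃ = 1`. The first term is due to the slopes of the two sections, the second one to
the variation of the vector field between them. -/
def transitionCoeff (B₀ X₀ B : ℝ) : ℝ :=
  -(2 * (2 * sectionTilt B₀ B X₀ + variationIntegral B X₀))

theorem continuousOn_integral_variable {U : Set ℝ} {f : ℝ → ℝ → ℝ} {l r : ℝ → ℝ}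
    (hl : ContinuousOn l U) (hr : ContinuousOn r U) (hlr : ∀ B ∈ U, l B ≤ r B)
    (hf : ContinuousOn (fun p : ℝ × ℝ => f p.1 p.2) {p | p.1 ∈ U ∧ p.2 ∈ Icc (l p.1) (r p.1)}) :
    ContinuousOn (fun B => ∫ y in l B..r B, f B y) U := by
  have hEq : ∀ B, ∫ y in l B..r B, f B y =
      (r B - l B) * ∫ t in (0 : ℝ)..1, f B ((r B - l B) * projIcc 0 1 zero_le_one t + l B) := by
    intro B
    have h := intervalIntegral.mul_integral_comp_mul_add (a := 0) (b := 1) (f := f B)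
      (r B - l B) (l B)
    simp only [mul_zero, zero_add, mul_one, sub_add_cancel] at h
    rw [← h]
    congr 1
    refine intervalIntegral.integral_congr fun t ht => ?_
    rw [uIcc_of_le zero_le_one] at ht
    simp only [projIcc_of_mem _ ht]
  simp only [hEq]
  refine (hr.sub hl).mul ?_
  rw [continuousOn_iff_continuous_domRestrict]
  have hl' : Continuous fun p : U × ℝ => l p.1 :=
    (continuousOn_iff_continuous_domRestrict.1 hl).comp continuous_fst
  have hr' : Continuous fun p : U × ℝ => r p.1 :=
    (continuousOn_iff_continuous_domRestrict.1 hr).comp continuous_fst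
  have hp : Continuous fun p : U × ℝ => ((projIcc 0 1 zero_le_one p.2 : Icc (0 : ℝ) 1) : ℝ) :=
    continuous_subtype_val.comp (continuous_projIcc.comp continuous_snd)
  refine intervalIntegral.continuous_parametric_intervalIntegral_of_continuous'
    (f := fun (B : U) t => f B ((r B - l B) * projIcc 0 1 zero_le_one t + l B)) ?_ 0 1
  refine hf.comp_continuous (f := fun p : U × ℝ =>
    ((p.1 : ℝ), (r p.1 - l p.1) * (projIcc 0 1 zero_le_one p.2 : Icc (0 : ℝ) 1) + l p.1))
    ((continuous_subtype_val.comp continuous_fst).prodMk (((hr'.sub hl').mul hp).add hl'))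
    fun p => ⟨p.1.2, ?_⟩
  have h1 := hlr p.1 p.1.2
  obtain ⟨h2, h3⟩ := (projIcc (0 : ℝ) 1 zero_le_one p.2).2
  constructor <;> nlinarith

theorem continuousOn_beta : ContinuousOn beta (Ioi (1 / 2)) := by
  unfold beta
  refine ContinuousOn.sqrt (continuousOn_const.div (by fun_prop) fun B hB => ?_)
  have : (1 : ℝ) / 2 < B := hB
  linarith

theorem continuousOn_transitionCoeff {B₀ X₀ : ℝ} (hX : 0 < X₀) {U : Set ℝ}
    (hU : ∀ B ∈ U, 1 / 2 < B ∧ 2 * X₀ < beta B ∧ (ratio B₀ ≠ 1 → ratio B ≠ 1)) :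
    ContinuousOn (transitionCoeff B₀ X₀) U := by
  have hβ : ContinuousOn beta U := continuousOn_beta.mono fun B hB => (hU B hB).1
  have hβ0 : ∀ B ∈ U, 0 < beta B := fun B hB => beta_pos (hU B hB).1
  have hσ : Continuous ratio := by unfold ratio; fun_prop
  have hσ0 : ∀ B ∈ U, ratio B ≠ 0 := fun B hB => (ratio_pos (hU B hB).1).ne'
  have ha : ContinuousOn (fun B => axisPt B X₀) U := by
    unfold axisPt
    fun_prop
  have ha0 : ∀ B ∈ U, 0 < axisPt B X₀ := fun B hB => axisPt_pos (hU B hB).2.1 (hβ0 B hB)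
  have hab : ∀ B ∈ U, axisPt B X₀ < beta B := fun B hB => axisPt_lt hX (hβ0 B hB)
  -- The integrands depend continuously on the parameter and the variable.
  have hwc : ∀ s : Set (ℝ × ℝ), (∀ p ∈ s, p.1 ∈ U) →
      ContinuousOn (fun p : ℝ × ℝ => weight p.1 X₀ p.2) s := fun s hs => by
    have h1 : ContinuousOn (fun p : ℝ × ℝ => beta p.1) s :=
      hβ.comp continuous_fst.continuousOn hs
    have h2 : ContinuousOn (fun p : ℝ × ℝ => ratio p.1) s := by fun_prop
    unfold weight
    refine ContinuousOn.rpow (ContinuousOn.div (by fun_prop) (by fun_prop) fun p hp => ?_)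
      (continuousOn_const.div h2 fun p hp => hσ0 _ (hs p hp)) fun p hp => Or.inr ?_
    · have := hβ0 _ (hs p hp)
      positivity
    · exact one_div_pos.2 (ratio_pos (hU _ (hs p hp)).1)
  have hDc : ∀ s : Set (ℝ × ℝ), (∀ p ∈ s, p.1 ∈ U) →
      ContinuousOn (fun p : ℝ × ℝ => axisRate p.1 p.2) s := fun s hs => by
    have h1 : ContinuousOn (fun p : ℝ × ℝ => beta p.1) s :=
      hβ.comp continuous_fst.continuousOn hs
    unfold axisRate
    fun_prop
  have hI : ContinuousOn (fun B => variationIntegral B X₀) U := by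
    unfold variationIntegral
    refine continuousOn_integral_variable ha.neg ha (fun B hB => by linarith [ha0 B hB])
      ((hwc _ fun p hp => hp.1).mul (ContinuousOn.div ?_ ?_ ?_))
    · exact ContinuousOn.sub (by fun_prop) (hDc _ fun p hp => hp.1)
    · exact (hDc _ fun p hp => hp.1).pow 2
    · rintro ⟨B, x⟩ ⟨hB, hx⟩
      exact (pow_pos (axisRate_pos (hU B hB).1 ((abs_le.2 hx).trans_lt (hab B hB))) 2).ne'
  have hinv : ContinuousOn (fun p : ℝ × ℝ => (p.2 ^ 2)⁻¹)
      {p | p.1 ∈ U ∧ p.2 ∈ Icc (axisPt p.1 X₀) (beta p.1)} :=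
    ContinuousOn.inv₀ (by fun_prop) fun p hp => (pow_pos ((ha0 _ hp.1).trans_le hp.2.1) 2).ne'
  have hK : ContinuousOn (fun B => sectionTilt B₀ B X₀) U := by
    unfold sectionTilt
    by_cases hres : ratio B₀ = 1
    · simp only [if_pos hres]
      have hc : ContinuousOn (fun B => 2 / ratio B) U :=
        continuousOn_const.div hσ.continuousOn hσ0
      refine (continuousOn_integral_variable ha hβ (fun B hB => (hab B hB).le)
        ((hwc _ fun p hp => hp.1).mul (hinv.add (ContinuousOn.mul
          (hc.comp continuous_fst.continuousOn fun p hp => hp.1) (ContinuousOn.inv₀ ?_ ?_))))).sub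
        ((ha.inv₀ fun B hB => (ha0 B hB).ne').add (hc.mul ((hβ.add ha).inv₀ ?_)))
      · have : ContinuousOn (fun p : ℝ × ℝ => beta p.1)
            {p | p.1 ∈ U ∧ p.2 ∈ Icc (axisPt p.1 X₀) (beta p.1)} :=
          hβ.comp continuous_fst.continuousOn fun p hp => hp.1
        fun_prop
      · rintro ⟨B, x⟩ ⟨hB, hx⟩
        have h1 := hβ0 B hB
        have h2 : 0 < x := (ha0 B hB).trans_le hx.1
        positivity
      · intro B hB
        exact (add_pos (hβ0 B hB) (ha0 B hB)).ne'
    · simp only [if_neg hres]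
      have hσ1 : ∀ B ∈ U, ratio B - 1 ≠ 0 := fun B hB => sub_ne_zero.2 ((hU B hB).2.2 hres)
      have hDa : ContinuousOn (fun B => axisRate B (axisPt B X₀)) U := by
        unfold axisRate
        fun_prop
      refine ((hσ.continuousOn.div (by fun_prop) hσ1).mul
        ((continuousOn_integral_variable ha hβ (fun B hB => (hab B hB).le)
          ((hwc _ fun p hp => hp.1).mul hinv)).sub (ha.inv₀ fun B hB => (ha0 B hB).ne'))).sub
        (ha.div ((by fun_prop : ContinuousOn (fun B => ratio B - 1) U).mul hDa) fun B hB =>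
          mul_ne_zero (hσ1 B hB) (axisRate_pos (hU B hB).1 ?_).ne')
      rw [abs_of_pos (ha0 B hB)]
      exact hab B hB
  unfold transitionCoeff
  fun_prop

section Nonvanishing

variable {B X₀ : ℝ}

theorem weight_nonneg (hB : 1 / 2 < B) (hX : 0 < X₀) {x : ℝ} (hx : |x| ≤ beta B) :
    0 ≤ weight B X₀ x := by
  have hβ := beta_pos hB
  have h := sq_le_sq' (neg_le_of_abs_le hx) (le_of_abs_le hx)
  exact Real.rpow_nonneg (div_nonneg (by linarith) (by positivity)) _

theorem weight_le_one (hB : 1 / 2 < B) (hX : 0 < X₀) (hX' : 2 * X₀ < beta B) {x : ℝ}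
    (hx : x ∈ Icc (axisPt B X₀) (beta B)) : weight B X₀ x ≤ 1 := by
  have hβ := beta_pos hB
  have ha := axisPt_pos hX' hβ
  have h1 := pow_le_pow_left₀ ha.le hx.1 2
  have h2 := pow_le_pow_left₀ (ha.le.trans hx.1) hx.2 2
  rw [axisPt_sq hX' hβ] at h1
  refine Real.rpow_le_one (div_nonneg (by linarith) (by positivity)) ?_
    (one_div_pos.2 (ratio_pos hB)).le
  rw [div_le_one (by positivity)]
  linarith

theorem integral_weight_div_sq_le (hB : 1 / 2 < B) (hX : 0 < X₀) (hX' : 2 * X₀ < beta B) :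
    ∫ y in axisPt B X₀..beta B, weight B X₀ y * (y ^ 2)⁻¹ ≤ (axisPt B X₀)⁻¹ - (beta B)⁻¹ := by
  have hβ := beta_pos hB
  have ha := axisPt_pos hX' hβ
  have hab := axisPt_lt hX hβ
  have hne : ∀ y ∈ Icc (axisPt B X₀) (beta B), y ≠ 0 := fun y hy => (ha.trans_le hy.1).ne'
  have hc : ContinuousOn (fun y : ℝ => (y ^ 2)⁻¹) (Icc (axisPt B X₀) (beta B)) :=
    ContinuousOn.inv₀ (by fun_prop) fun y hy => pow_ne_zero 2 (hne y hy)
  have hi := hc.intervalIntegrable_of_Icc (μ := MeasureTheory.volume) hab.le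
  have h1 : ∫ y in axisPt B X₀..beta B, (y ^ 2)⁻¹ = (axisPt B X₀)⁻¹ - (beta B)⁻¹ := by
    rw [intervalIntegral.integral_eq_sub_of_hasDerivAt (f := fun y => -y⁻¹) (fun y hy => ?_) hi]
    · ring
    · rw [uIcc_of_le hab.le] at hy
      exact (hasDerivAt_inv (hne y hy)).neg.congr_deriv (neg_neg _)
  rw [← h1]
  refine intervalIntegral.integral_mono_on hab.le
    (((continuous_weight hB).continuousOn.mul hc).intervalIntegrable_of_Icc hab.le) hi
    fun y hy => ?_
  have : 0 ≤ (y ^ 2)⁻¹ := by positivity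
  exact mul_le_of_le_one_left this (weight_le_one hB hX hX' hy)

/-- Integration of `(x w / D)' = w / D + (σ - 1) x² w / D²`. -/
theorem variationIntegral_mul (hB : 1 / 2 < B) (hX : 0 < X₀) (hX' : 2 * X₀ < beta B) :
    (ratio B - 1) * variationIntegral B X₀ =
      2 * axisPt B X₀ / axisRate B (axisPt B X₀) -
        ratio B * ∫ x in (-axisPt B X₀)..axisPt B X₀, weight B X₀ x / axisRate B x := by
  have hβ := beta_pos hB
  have ha := axisPt_pos hX' hβ
  have hab := axisPt_lt hX hβ
  have hle : -axisPt B X₀ ≤ axisPt B X₀ := by linarith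
  have habs : ∀ x ∈ Icc (-axisPt B X₀) (axisPt B X₀), |x| < beta B := fun x hx =>
    (abs_le.2 hx).trans_lt hab
  have hD : ∀ x ∈ Icc (-axisPt B X₀) (axisPt B X₀), axisRate B x ≠ 0 := fun x hx =>
    (axisRate_pos hB (habs x hx)).ne'
  have hDc := continuous_axisRate B
  have hwc := continuous_weight (X₀ := X₀) hB
  have hi1 : IntervalIntegrable
      (fun x => weight B X₀ x * ((x ^ 2 - axisRate B x) / axisRate B x ^ 2))
      MeasureTheory.volume (-axisPt B X₀) (axisPt B X₀) :=
    (hwc.continuousOn.mul (ContinuousOn.div (by fun_prop) (by fun_prop)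
      fun x hx => pow_ne_zero 2 (hD x hx))).intervalIntegrable_of_Icc hle
  have hi2 : IntervalIntegrable (fun x => weight B X₀ x / axisRate B x)
      MeasureTheory.volume (-axisPt B X₀) (axisPt B X₀) :=
    (hwc.continuousOn.div hDc.continuousOn hD).intervalIntegrable_of_Icc hle
  have h := intervalIntegral.integral_eq_sub_of_hasDerivAt
    (f := fun x => x * weight B X₀ x / axisRate B x)
    (f' := fun x => (ratio B - 1) *
      (weight B X₀ x * ((x ^ 2 - axisRate B x) / axisRate B x ^ 2)) +
        ratio B * (weight B X₀ x / axisRate B x))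
    (a := -axisPt B X₀) (b := axisPt B X₀) (fun x hx => by
      rw [uIcc_of_le hle] at hx
      have h0 := hD x hx
      refine (((hasDerivAt_id' x).fun_mul (hasDerivAt_weight hB hX (habs x hx))).fun_div
        (hasDerivAt_axisRate B x) h0).congr_deriv ?_
      field_simp
      ring) ((hi1.const_mul _).add (hi2.const_mul _))
  rw [intervalIntegral.integral_add (hi1.const_mul _) (hi2.const_mul _),
    intervalIntegral.integral_const_mul, intervalIntegral.integral_const_mul, weight_neg,
    axisRate_neg, weight_axisPt hX hX' hβ] at h
  rw [variationIntegral]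
  linear_combination h

theorem transitionCoeff_ne_zero_of_ratio_ne_one (hB : 1 / 2 < B) (hX : 0 < X₀)
    (hX' : 2 * X₀ < beta B) (hσ : ratio B ≠ 1) : transitionCoeff B X₀ B ≠ 0 := by
  have hβ := beta_pos hB
  have ha := axisPt_pos hX' hβ
  have hab := axisPt_lt hX hβ
  have hσ1 : ratio B - 1 ≠ 0 := sub_ne_zero.2 hσ
  have hJ := integral_weight_div_sq_le hB hX hX'
  have hI := variationIntegral_mul hB hX hX'
  have hW : 0 ≤ ∫ x in (-axisPt B X₀)..axisPt B X₀, weight B X₀ x / axisRate B x :=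
    intervalIntegral.integral_nonneg (by linarith) fun x hx =>
      have hx' := (abs_le.2 hx).trans_lt hab
      div_nonneg (weight_nonneg hB hX hx'.le) (axisRate_pos hB hx').le
  have hDa : axisRate B (axisPt B X₀) ≠ 0 :=
    (axisRate_pos hB (by rwa [abs_of_pos ha])).ne'
  set J := ∫ y in axisPt B X₀..beta B, weight B X₀ y * (y ^ 2)⁻¹
  set W := ∫ x in (-axisPt B X₀)..axisPt B X₀, weight B X₀ x / axisRate B x
  have key : (ratio B - 1) * (2 * sectionTilt B B X₀ + variationIntegral B X₀) =
      ratio B * (2 * J - 2 * (axisPt B X₀)⁻¹ - W) := by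
    rw [mul_add, hI, sectionTilt, if_neg hσ]
    change (ratio B - 1) * (2 * (ratio B / (ratio B - 1) * (J - (axisPt B X₀)⁻¹) -
      axisPt B X₀ / ((ratio B - 1) * axisRate B (axisPt B X₀)))) + _ = _
    generalize J = J', W = W'
    field_simp
    ring
  intro h0
  have h1 : 2 * sectionTilt B B X₀ + variationIntegral B X₀ = 0 := by
    unfold transitionCoeff at h0
    linarith
  rw [h1, mul_zero] at key
  have h2 := (mul_eq_zero.1 key.symm).resolve_left (ratio_pos hB).ne'
  have h3 := inv_pos.2 hβ
  linarith

/-- In the resonant case the terms of the coefficient have different signs, and `X₀` is required to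
be so small that the logarithm in `variationIntegral` dominates. -/
theorem transitionCoeff_ne_zero_of_ratio_eq_one (hσ : ratio B = 1) (hX : 0 < X₀)
    (hX' : X₀ < Real.exp (-4)) : transitionCoeff B X₀ B ≠ 0 := by
  have hB2 : 2 * B - 1 = 1 / 2 := by
    unfold ratio at hσ
    linarith
  have hB : 1 / 2 < B := by linarith
  have hβ : beta B = 2 := by
    rw [beta, hB2, Real.sqrt_eq_iff_mul_self_eq_of_pos two_pos]
    norm_num
  have hXe : X₀ < 1 / 5 := by
    have h1 := Real.add_one_le_exp (4 : ℝ)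
    rw [Real.exp_neg] at hX'
    refine hX'.trans_le ?_
    rw [one_div]
    exact inv_anti₀ (by norm_num) (by linarith)
  have hXβ : 2 * X₀ < beta B := by
    rw [hβ]
    linarith
  have hβ0 := beta_pos hB
  have ha := axisPt_pos hXβ hβ0
  have hab := axisPt_lt hX hβ0
  have hasq := axisPt_sq hXβ hβ0
  rw [hβ] at hab hasq
  have ha1 : 1 < axisPt B X₀ := by
    by_contra! h
    nlinarith
  have hK : -4 < 2 * sectionTilt B B X₀ := by
    have h1 : 0 ≤ ∫ y in axisPt B X₀..beta B,
        weight B X₀ y * ((y ^ 2)⁻¹ + 2 / ratio B * ((beta B + y) ^ 2)⁻¹) := by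
      refine intervalIntegral.integral_nonneg (axisPt_lt hX hβ0).le fun y hy => ?_
      refine mul_nonneg (weight_nonneg hB hX ?_) ?_
      · rw [abs_of_pos (ha.trans_le hy.1)]
        exact hy.2
      · rw [hσ]
        positivity
    rw [sectionTilt, if_pos hσ]
    have h2 : (axisPt B X₀)⁻¹ < 1 := inv_lt_one_of_one_lt₀ ha1
    have h3 : (beta B + axisPt B X₀)⁻¹ < 1 / 2 := by
      rw [one_div]
      exact inv_strictAnti₀ two_pos (by linarith)
    rw [hσ] at h1 ⊢
    linarith
  have hI : variationIntegral B X₀ = (8 * (Real.log (2 + axisPt B X₀) -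
      Real.log (2 - axisPt B X₀)) - 12 * axisPt B X₀) / (4 * X₀) := by
    have hle : -axisPt B X₀ ≤ axisPt B X₀ := by linarith
    have hDc := continuous_axisRate B
    have hD : ∀ x ∈ Icc (-axisPt B X₀) (axisPt B X₀), axisRate B x ≠ 0 := fun x hx =>
      (axisRate_pos hB ((abs_le.2 hx).trans_lt (by rwa [hβ]))).ne'
    have hi : IntervalIntegrable
        (fun x => weight B X₀ x * ((x ^ 2 - axisRate B x) / axisRate B x ^ 2))
        MeasureTheory.volume (-axisPt B X₀) (axisPt B X₀) :=
      ((continuous_weight hB).continuousOn.mul (ContinuousOn.div (by fun_prop) (by fun_prop)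
        fun x hx => pow_ne_zero 2 (hD x hx))).intervalIntegrable_of_Icc hle
    have hd : ∀ x ∈ uIcc (-axisPt B X₀) (axisPt B X₀), HasDerivAt
        (fun x => (4 * (Real.log (2 + x) - Real.log (2 - x)) - 6 * x) / (4 * X₀))
        (weight B X₀ x * ((x ^ 2 - axisRate B x) / axisRate B x ^ 2)) x := by
      intro x hx
      rw [uIcc_of_le hle] at hx
      have h1 : 2 + x ≠ 0 := by linarith [hx.1]
      have h2 : 2 - x ≠ 0 := by linarith [hx.2]
      refine (((((((hasDerivAt_id' x).const_add 2).log h1).fun_sub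
        (((hasDerivAt_id' x).const_sub 2).log h2)).const_mul 4).fun_sub
          ((hasDerivAt_id' x).const_mul 6)).div_const (4 * X₀)).congr_deriv ?_
      rw [weight, axisRate, hβ, hσ, hB2, one_div_one, Real.rpow_one]
      have h4 : (2 : ℝ) ^ 2 - x ^ 2 = (2 + x) * (2 - x) := by ring
      rw [h4]
      field_simp
      ring
    rw [variationIntegral, intervalIntegral.integral_eq_sub_of_hasDerivAt hd hi,
      ← sub_eq_add_neg, sub_neg_eq_add]
    ring
  have hlog : 4 < Real.log (2 + axisPt B X₀) - Real.log (2 - axisPt B X₀) := by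
    rw [← Real.log_div (by linarith) (by linarith), Real.lt_log_iff_exp_lt
      (div_pos (by linarith) (by linarith)), lt_div_iff₀ (by linarith)]
    have h1 : X₀ * Real.exp 4 < 1 := by
      have := mul_lt_mul_of_pos_right hX' (Real.exp_pos 4)
      rwa [← Real.exp_add, neg_add_cancel, Real.exp_zero] at this
    have h2 : 2 - axisPt B X₀ < 2 * X₀ := by nlinarith
    have h3 := mul_lt_mul_of_pos_left h2 (Real.exp_pos 4)
    linarith
  have hI4 : 4 < variationIntegral B X₀ := by
    rw [hI, lt_div_iff₀ (by positivity)]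
    linarith
  unfold transitionCoeff
  intro h0
  linarith

end Nonvanishing

theorem exists_range_of_coeff {B₀ X₀ : ℝ} (hB₀ : 1 / 2 < B₀) (hX : 0 < X₀)
    (hX₁ : 2 * X₀ < beta B₀) (hX₂ : X₀ < Real.exp (-4)) :
    ∃ δ > 0, ContinuousOn (transitionCoeff B₀ X₀) (Ioo (B₀ - δ) (B₀ + δ)) ∧
      ∀ B ∈ Ioo (B₀ - δ) (B₀ + δ), transitionCoeff B₀ X₀ B ≠ 0 ∧ 1 / 2 < B ∧ 2 * X₀ < beta B ∧
        (ratio B₀ ≠ 1 → ratio B ≠ 1) := by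
  have hc0 : transitionCoeff B₀ X₀ B₀ ≠ 0 := by
    by_cases h : ratio B₀ = 1
    · exact transitionCoeff_ne_zero_of_ratio_eq_one h hX hX₂
    · exact transitionCoeff_ne_zero_of_ratio_ne_one hB₀ hX hX₁ h
  have hβc : ContinuousAt beta B₀ := continuousOn_beta.continuousAt (Ioi_mem_nhds hB₀)
  have hσc : Continuous ratio := by unfold ratio; fun_prop
  have hev : ∀ᶠ B in 𝓝 B₀, 1 / 2 < B ∧ 2 * X₀ < beta B ∧ (ratio B₀ ≠ 1 → ratio B ≠ 1) := by
    refine (lt_mem_nhds hB₀).and ((continuousAt_const.eventually_lt hβc hX₁).and ?_)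
    by_cases h : ratio B₀ = 1
    · simp [h]
    · exact (hσc.continuousAt.eventually_ne h).mono fun B hB _ => hB
  have hcat : ContinuousAt (transitionCoeff B₀ X₀) B₀ :=
    (continuousOn_transitionCoeff hX fun B hB => hB).continuousAt hev
  obtain ⟨δ, hδ, h⟩ := Metric.eventually_nhds_iff_ball.1 ((hcat.eventually_ne hc0).and hev)
  rw [Real.ball_eq_Ioo] at h
  exact ⟨δ, hδ, continuousOn_transitionCoeff hX fun B hB => (h B hB).2, h⟩

/-! ### The transition factor -/

section Transition

variable {u : Unfolding} {B₀ : ℝ} {A : Params} {s : ℝ} {k : ℕ} {e : ℝ} {G : ℝ × ℝ × ℝ → ℝ} {X₀ : ℝ}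

theorem chartSection_plane_injective (h : IsNormalizingChart u B₀ A s k e G) {ρ x x' : ℝ}
    (hx : (0, ρ, x) ∈ chartSection A.B s e G X₀) (hx' : (0, ρ, x') ∈ chartSection A.B s e G X₀) :
    x = x' := by
  have h1 := h.injOn hx.1 hx'.1 (by simp [hx.2, hx'.2])
  simpa using h1

/-- The slope of a section where it meets the axis. The section may be parameterized by any function
`P` of `ρ` with `P(0) = 0` and `P'(0) = 1`. -/
theorem IsNormalizingChart.section_slope (h : IsNormalizingChart u B₀ A s k e G)
    (hk : 2 ≤ k) (hs : s * s = 1) (hB : 1 / 2 < A.B) (hX : 0 < X₀) (hX' : 2 * X₀ < beta A.B)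
    (hσ : ratio B₀ ≠ 1 → ratio A.B ≠ 1) (ha : |axisPt A.B X₀ - beta A.B| < e)
    {P x : ℝ → ℝ} (hP0 : P 0 = 0) (hP : HasDerivAt P 1 0) (hx0 : x 0 = s * axisPt A.B X₀)
    (hx : DifferentiableAt ℝ x 0) (hG : ∀ᶠ ρ in 𝓝 0, G (0, P ρ, x ρ) = X₀) :
    HasDerivAt x (A.mu3 * sectionTilt B₀ A.B X₀ * axisRate A.B (axisPt A.B X₀) / axisPt A.B X₀)
      0 := by
  have hβ := beta_pos hB
  have ha0 := axisPt_pos hX' hβ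
  have htilt := h.fderiv_rho hk hs hB hX hX' hσ ha
  obtain ⟨-, hGx⟩ := (h.axis_equations hk hs hB).1 _ ha
  have hGd : HasFDerivAt G (fderiv ℝ G (0, 0, s * axisPt A.B X₀)) (0, P 0, x 0) := by
    rw [hP0, hx0]
    exact ((h.contDiffAt hk ((mem_chart_ball_axis hs h.pos).2 ha)).differentiableAt
      (by simp)).hasFDerivAt
  have hc := hGd.comp_hasDerivAt (0 : ℝ)
    ((hasDerivAt_const (0 : ℝ) (0 : ℝ)).prodMk (hP.prodMk hx.hasDerivAt))
  have h1 := hc.unique ((hasDerivAt_const (0 : ℝ) X₀).congr_of_eventuallyEq hG)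
  have h2 : ((0 : ℝ), (1 : ℝ), deriv x 0) =
      (0, 1, 0) + deriv x 0 • ((0 : ℝ), (0 : ℝ), (1 : ℝ)) := by simp
  rw [h2, map_add, map_smul, smul_eq_mul, hGx] at h1
  refine hx.hasDerivAt.congr_deriv ?_
  rw [eq_div_iff ha0.ne']
  field_simp at h1
  linear_combination htilt - s * h1 + deriv x 0 * axisPt A.B X₀ * (-hs)

variable {e₃ e₄ : ℝ} {G₃ G₄ : ℝ × ℝ × ℝ → ℝ}

/-- There is a transition factor `F = exp (h(0))` of class `C²`. On the plane `r = 0` the section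
`Σ₃` is a graph `x̄ = x₃(ρ)`, and the last two lines of the statement hold for the points of this
graph. -/
theorem exists_smooth_transitionFactor (hk : 2 ≤ k) (hB : 1 / 2 < A.B) (hX : 0 < X₀)
    (hX' : 2 * X₀ < beta A.B) (hσ : ratio B₀ ≠ 1 → ratio A.B ≠ 1)
    (hc₃ : IsNormalizingChart u B₀ A 1 k e₃ G₃) (hc₄ : IsNormalizingChart u B₀ A (-1) k e₄ G₄)
    (hs₃ : ∃ x₃ : ℝ, (0, 0, x₃) ∈ chartSection A.B 1 e₃ G₃ X₀)
    (hs₄ : ∃ x₄ : ℝ, (0, 0, x₄) ∈ chartSection A.B (-1) e₄ G₄ X₀) :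
    ∃ (F : ℝ × ℝ → ℝ) (x₃ : ℝ → ℝ),
      IsTransitionFactor (blowUpField u A) (chartSection A.B 1 e₃ G₃ X₀)
        (chartSection A.B (-1) e₄ G₄ X₀) F ∧
      F 0 = 1 ∧ ContDiffAt ℝ 2 (fun ρ => F (0, ρ)) 0 ∧
      HasDerivAt (fun ρ => F (0, ρ)) (transitionCoeff B₀ X₀ A.B * A.mu3 / 2) 0 ∧
      ContDiffAt ℝ 1 x₃ 0 ∧ x₃ 0 = axisPt A.B X₀ ∧
      ∀ᶠ ρ in 𝓝 (0 : ℝ), (0, ρ, x₃ ρ) ∈ chartSection A.B 1 e₃ G₃ X₀ ∧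
        ∃ x₄, (0, ρ * (F (0, ρ))⁻¹, x₄) ∈ chartSection A.B (-1) e₄ G₄ X₀ ∧
          FlowsTo (blowUpField u A) (0, ρ * (F (0, ρ))⁻¹, x₄) (0, ρ, x₃ ρ) := by
  have hβ := beta_pos hB
  have ha := axisPt_pos hX' hβ
  have hab := axisPt_lt hX hβ
  obtain ⟨y₃, hy₃⟩ := hs₃
  obtain ⟨y₄, hy₄⟩ := hs₄
  obtain ⟨rfl, he₃⟩ := hc₃.eq_of_mem_chartSection hk (mul_one 1) hB hy₃
  obtain ⟨rfl, he₄⟩ := hc₄.eq_of_mem_chartSection hk (by norm_num) hB hy₄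
  have hGx₃ := ((hc₃.axis_equations hk (mul_one 1) hB).1 _ he₃).2
  have hGx₄ := ((hc₄.axis_equations hk (by norm_num) hB).1 _ he₄).2
  simp only [one_mul, neg_one_mul, neg_neg] at hy₃ hy₄ hGx₃ hGx₄
  set a := axisPt A.B X₀ with ha_def
  obtain ⟨h, q, x₃, x₄, hh, hq, hx₃, hx₄, hx₃0, hx₄0, hev⟩ :=
    exists_smooth_trajectories u A hB ha hab (hc₃.contDiffAt hk hy₃.1) (hc₄.contDiffAt hk hy₄.1)
      (by rw [hGx₃]; exact div_ne_zero (by simpa using ha.ne') hβ.ne')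
      (by rw [hGx₄]; exact div_ne_zero ha.ne' hβ.ne') hy₃.2 hy₄.2
  set t₀ : Icc (0 : ℝ) 1 := ⟨0, by simp⟩
  have ht₀ : ((t₀ : Icc (0 : ℝ) 1) : ℝ) = 0 := rfl
  have hht : ContDiffAt ℝ 2 (fun z => h z t₀) 0 :=
    (ContinuousMap.evalCLM (M := ℝ) ℝ t₀).contDiff.contDiffAt.comp _ hh
  -- On the axis itself the trajectory is known.
  have hw : ∀ t : Icc (0 : ℝ) 1, Real.exp (-h 0 t) = weight A.B X₀ (-a + t * (a - -a)) := by
    obtain ⟨hv, -, hq0, -⟩ := hev.self_of_nhds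
    refine exp_neg_volterra_eq_weight hB hX hX' hv fun t => ?_
    rw [(hq0 t).2, hx₃0, hx₄0]
    simp only [scaledPt, Prod.fst_zero, Prod.snd_zero, zero_mul, rate_plane, mul_zero, sub_zero,
      xRate_axis hB u rfl]
    rfl
  have hh0 : h 0 t₀ = 0 := by
    have h1 := hw t₀
    rw [ht₀, zero_mul, add_zero, weight_neg, weight_axisPt hX hX' hβ, Real.exp_eq_one_iff] at h1
    linarith
  have hev₃ : ∀ᶠ z in 𝓝 (0 : ℝ × ℝ), (z.1, z.2, x₃ z) ∈ chartSection A.B 1 e₃ G₃ X₀ := by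
    have hc : ContinuousAt (fun z : ℝ × ℝ => (z.1, z.2, x₃ z)) 0 :=
      continuousAt_fst.prodMk (continuousAt_snd.prodMk hx₃.continuousAt)
    filter_upwards [hev, hc.eventually (Metric.isOpen_ball.mem_nhds
      (by simpa only [Prod.fst_zero, Prod.snd_zero, hx₃0] using hy₃.1))] with z hz hz'
    exact ⟨hz', hz.2.2.2.1⟩
  have hev₄ : ∀ᶠ z in 𝓝 (0 : ℝ × ℝ),
      scaledPt z (h z t₀) (x₄ z) ∈ chartSection A.B (-1) e₄ G₄ X₀ := by
    have hc : ContinuousAt (fun z : ℝ × ℝ => scaledPt z (h z t₀) (x₄ z)) 0 := by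
      have h1 := hht.continuousAt
      have h2 := hx₄.continuousAt
      unfold scaledPt
      fun_prop
    filter_upwards [hev, hc.eventually (Metric.isOpen_ball.mem_nhds
      (by simpa only [scaledPt, Prod.fst_zero, Prod.snd_zero, zero_mul, hx₄0] using hy₄.1))]
      with z hz hz'
    exact ⟨hz', hz.2.2.2.2⟩
  have hflow : ∀ᶠ z in 𝓝 (0 : ℝ × ℝ),
      FlowsTo (blowUpField u A) (scaledPt z (h z t₀) (x₄ z)) (z.1, z.2, x₃ z) :=
    hev.mono fun z hz => flowsTo_of_integral_equation u A z hz.1 hz.2.1 hz.2.2.1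
  have hinj : ContDiff ℝ 2 fun ρ : ℝ => ((0 : ℝ), ρ) := by fun_prop
  have hplane : Tendsto (fun ρ : ℝ => ((0 : ℝ), ρ)) (𝓝 0) (𝓝 (0 : ℝ × ℝ)) :=
    hinj.continuous.tendsto' 0 0 rfl
  have hplaneC : ∀ {E : Type} [NormedAddCommGroup E] [NormedSpace ℝ E] {f : ℝ × ℝ → E},
      ContDiffAt ℝ 2 f 0 → ContDiffAt ℝ 2 (fun ρ : ℝ => f (0, ρ)) 0 := fun {E} _ _ f hf =>
    ContDiffAt.comp (0 : ℝ) (g := f) (f := fun ρ : ℝ => ((0 : ℝ), ρ)) hf hinj.contDiffAt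
  have hqp := hplaneC hq
  have hhp := hplaneC hht
  have hx₃p := hplaneC hx₃
  have hx₄p := hplaneC hx₄
  have hP : HasDerivAt (fun ρ => ρ * Real.exp (-h (0, ρ) t₀)) 1 0 := by
    refine ((hasDerivAt_id' (0 : ℝ)).fun_mul
      (hhp.differentiableAt (by simp)).hasDerivAt.fun_neg.exp).congr_deriv ?_
    have : h (0, 0) t₀ = 0 := hh0
    simp [this]
  have hslope₃ := hc₃.section_slope hk (mul_one 1) hB hX hX' hσ he₃ (P := fun ρ => ρ) rfl
    (hasDerivAt_id' 0) (by rw [one_mul]; exact hx₃0) (hx₃p.differentiableAt (by simp))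
    ((hplane.eventually hev₃).mono fun ρ hρ => hρ.2)
  have hslope₄ := hc₄.section_slope hk (by norm_num) hB hX hX' hσ he₄
    (P := fun ρ => ρ * Real.exp (-h (0, ρ) t₀)) (zero_mul _) hP
    (by rw [neg_one_mul]; exact hx₄0) (hx₄p.differentiableAt (by simp))
    ((hplane.eventually hev₄).mono fun ρ hρ => by simpa only [scaledPt, zero_mul] using hρ.2)
  have hlog := hasDerivAt_log_factor u A hB hX hX' (h := fun ρ => h (0, ρ))
    (q := fun ρ => q (0, ρ)) (hqp.differentiableAt (by simp)) hslope₃ hslope₄ hx₃0 hx₄0 hw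
    ((hplane.eventually hev).mono fun ρ hρ => ⟨hρ.1, fun t => (hρ.2.2.1 t).2⟩)
  have hF0 : Real.exp (h 0 t₀) = 1 := by rw [hh0, Real.exp_zero]
  have hscaled : ∀ z x, scaledPt z (h z t₀) x =
      (z.1 * Real.exp (h z t₀), z.2 * (Real.exp (h z t₀))⁻¹, x) := fun z x => by
    rw [scaledPt, Real.exp_neg]
  refine ⟨fun z => Real.exp (h z t₀), fun ρ => x₃ (0, ρ), ⟨hht.continuousAt.rexp,
    (Real.exp_pos _).ne', ?_⟩, hF0, hhp.exp, ?_, hx₃p.of_le (by norm_num), hx₃0, ?_⟩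
  · filter_upwards [hev₃, hev₄, hflow] with z h1 h2 h3
    rw [hscaled] at h2 h3
    exact ⟨x₃ z, x₄ z, h1, h2, h3⟩
  · refine hlog.exp.congr_deriv ?_
    have hD : axisRate A.B a ≠ 0 := (axisRate_pos hB (by rwa [abs_of_pos ha])).ne'
    rw [show Real.exp (h (0, 0) t₀) = 1 from hF0, transitionCoeff, ← ha_def]
    field_simp
  · filter_upwards [hplane.eventually hev₃, hplane.eventually hev₄, hplane.eventually hflow]
      with ρ h1 h2 h3
    rw [hscaled, zero_mul] at h2 h3
    exact ⟨h1, x₄ (0, ρ), h2, h3⟩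

/-- Every transition factor agrees on `r = 0` with the one of class `C²`. At the origin itself, not
covered by `IsTransitionFactor.eventually_eq`, this follows from continuity. -/
theorem IsTransitionFactor.hasSecondDerivAt (hk : 2 ≤ k) (hB : 1 / 2 < A.B) (hX : 0 < X₀)
    (hX' : 2 * X₀ < beta A.B) (hσ : ratio B₀ ≠ 1 → ratio A.B ≠ 1)
    (hc₃ : IsNormalizingChart u B₀ A 1 k e₃ G₃) (hc₄ : IsNormalizingChart u B₀ A (-1) k e₄ G₄)
    (hs₃ : ∃ x₃ : ℝ, (0, 0, x₃) ∈ chartSection A.B 1 e₃ G₃ X₀)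
    (hs₄ : ∃ x₄ : ℝ, (0, 0, x₄) ∈ chartSection A.B (-1) e₄ G₄ X₀) {F : ℝ × ℝ → ℝ}
    (hF : IsTransitionFactor (blowUpField u A) (chartSection A.B 1 e₃ G₃ X₀)
      (chartSection A.B (-1) e₄ G₄ X₀) F) :
    F (0, 0) = 1 ∧
      HasSecondDerivAt (fun ρ => ρ * F (0, ρ)) (transitionCoeff B₀ X₀ A.B * A.mu3) 0 ∧
      HasSecondDerivAt (fun ρ => ρ * (F (0, ρ))⁻¹) (-(transitionCoeff B₀ X₀ A.B * A.mu3)) 0 := by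
  have hβ := beta_pos hB
  obtain ⟨f, x₃, -, hf0, hfC, hfd, hx₃, hx₃0, hcan⟩ :=
    exists_smooth_transitionFactor hk hB hX hX' hσ hc₃ hc₄ hs₃ hs₄
  have hf00 : f (0, 0) = 1 := hf0
  have hEq : ∀ᶠ ρ in 𝓝[≠] (0 : ℝ), F (0, ρ) = f (0, ρ) :=
    hF.eventually_eq (contDiff_blowUpField u A) (fun _ _ _ => chartSection_plane_injective hc₃)
      (fun _ _ _ => chartSection_plane_injective hc₄) (hfC.of_le (by norm_num)) hf00 hcan
      (eq_of_flowsTo_of_graph u A hB (axisPt_pos hX' hβ) (axisPt_lt hX hβ) hx₃ hx₃0)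
  have hF0 : F (0, 0) = 1 := by
    have h1 : Tendsto (fun ρ : ℝ => F (0, ρ)) (𝓝[≠] 0) (𝓝 (F (0, 0))) :=
      (ContinuousAt.comp (x := (0 : ℝ)) (g := F) (f := fun ρ : ℝ => ((0 : ℝ), ρ)) hF.1
        (by fun_prop)).continuousWithinAt
    have h2 : Tendsto (fun ρ : ℝ => f (0, ρ)) (𝓝[≠] 0) (𝓝 (f (0, 0))) :=
      hfC.continuousAt.continuousWithinAt
    rw [tendsto_nhds_unique (h1.congr' hEq) h2, hf00]
  have hEq' : ∀ᶠ ρ in 𝓝 (0 : ℝ), F (0, ρ) = f (0, ρ) := by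
    filter_upwards [eventually_nhdsWithin_iff.1 hEq] with ρ hρ
    by_cases h : ρ = 0
    · rw [h, hF0, hf00]
    · exact hρ h
  refine ⟨hF0, ?_, ?_⟩
  · have h1 := (hasSecondDerivAt_id_mul hfC hfd).congr (R := fun ρ => ρ * F (0, ρ))
      (hEq'.mono fun ρ hρ => by simp only [hρ])
    rwa [mul_div_cancel₀ _ two_ne_zero] at h1
  · have hne : f (0, 0) ≠ 0 := by rw [hf00]; exact one_ne_zero
    have h1 := (hasSecondDerivAt_id_mul (hfC.inv hne) (hfd.fun_inv hne)).congr
      (R := fun ρ => ρ * (F (0, ρ))⁻¹) (hEq'.mono fun ρ hρ => by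
        simp only [hρ, Pi.inv_apply])
    rwa [hf00, one_pow, div_one, mul_neg, mul_div_cancel₀ _ two_ne_zero] at h1

end Transition

end NilpotentBlowUp

end

open NilpotentBlowUp in
theorem mainTheorem9 (B₀ : ℝ) (hB₀ : 1 / 2 < B₀) :
    ∃ Xmax : ℝ, 0 < Xmax ∧ ∀ X₀ : ℝ, 0 < X₀ → X₀ < Xmax →
      ∃ δ : ℝ, 0 < δ ∧ ∃ c : ℝ → ℝ,
        ContinuousOn c (Set.Ioo (B₀ - δ) (B₀ + δ)) ∧
        (∀ B ∈ Set.Ioo (B₀ - δ) (B₀ + δ), c B ≠ 0) ∧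
        ∀ (u : Unfolding) (A : Params), A.B ∈ Set.Ioo (B₀ - δ) (B₀ + δ) →
        ∀ (k : ℕ), 2 ≤ k → ∀ (e₃ e₄ : ℝ) (G₃ G₄ : ℝ × ℝ × ℝ → ℝ),
          IsNormalizingChart u B₀ A 1 k e₃ G₃ →
          IsNormalizingChart u B₀ A (-1) k e₄ G₄ →
          (∃ x₃ : ℝ, (0, 0, x₃) ∈ chartSection A.B 1 e₃ G₃ X₀) →
          (∃ x₄ : ℝ, (0, 0, x₄) ∈ chartSection A.B (-1) e₄ G₄ X₀) →
          (∃ F : ℝ × ℝ → ℝ, IsTransitionFactor (blowUpField u A)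
            (chartSection A.B 1 e₃ G₃ X₀) (chartSection A.B (-1) e₄ G₄ X₀) F) ∧
          ∀ F : ℝ × ℝ → ℝ, IsTransitionFactor (blowUpField u A)
            (chartSection A.B 1 e₃ G₃ X₀) (chartSection A.B (-1) e₄ G₄ X₀) F →
            F (0, 0) = 1 ∧
            HasSecondDerivAt (fun ρ => ρ * F (0, ρ)) (c A.B * A.mu3) 0 ∧
            HasSecondDerivAt (fun ρ => ρ * (F (0, ρ))⁻¹) (-(c A.B * A.mu3)) 0 := by
  refine ⟨min (beta B₀ / 2) (Real.exp (-4)),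
    lt_min (half_pos (beta_pos hB₀)) (Real.exp_pos _), fun X₀ hX hXmax => ?_⟩
  obtain ⟨hX₁, hX₂⟩ := lt_min_iff.1 hXmax
  obtain ⟨δ, hδ, hc, hrange⟩ := exists_range_of_coeff hB₀ hX (by linarith) hX₂
  refine ⟨δ, hδ, transitionCoeff B₀ X₀, hc, fun B hB => (hrange B hB).1,
    fun u A hA k hk e₃ e₄ G₃ G₄ hc₃ hc₄ hs₃ hs₄ => ?_⟩
  obtain ⟨-, hB, hX', hσ⟩ := hrange A.B hA
  obtain ⟨F, -, hF, -⟩ := exists_smooth_transitionFactor hk hB hX hX' hσ hc₃ hc₄ hs₃ hs₄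
  exact ⟨⟨F, hF⟩, fun F hF => hF.hasSecondDerivAt hk hB hX hX' hσ hc₃ hc₄ hs₃ hs₄⟩
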